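/- **Setting.** Let $\mathbf X=\mathbb R\times[0,1]^{\mathbb N}\times\{\star,0,1\}^{\mathbb N}$ with points $(x,s,\pi)$ and measure $\mu$ = Lebesgue measure on the first two factors times the measure giving mass $3^{-n}$ to the cylinder of a word of length $n$. The monoid $\mathfrak n_i$ of maps $\mathbf X\to\mathbf X$ is generated by the translations of $x$ by integers, the permutations of the first $i$ coordinates of $s$, and the stack operations $\mathtt{pop}:c\cdot\pi\mapsto\pi$ and $\mathtt{push}_a:\pi\mapsto a\cdot\pi$ ($a\in\{\star,0,1\}$); $\mathfrak n_\infty=\bigcup_{i\ge1}\mathfrak n_i$. Let $\Theta$ be the monoid generated by $0,1,\star,c$ with relations $c0=c1=c\star=\varepsilon$; it acts on stacks, $a$ acting as $\mathtt{push}_a$ and $c$ as $\mathtt{pop}$ (products act as compositions, and weights of paths are multiplied in the same order). Let $\Omega$ be a monoid (e.g. $[0,1]\times\{0,1\}$) and $u\in\Omega$ the weight of word edges (e.g. the weight written $1$). Let $\mathcal V=(\{0,1,\star\}\times\{\mathrm{In},\mathrm{Out}\})\cup\{\mathtt a,\mathtt r\}$, and let $\Psi$ send the elements of $\mathcal V$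 injectively to intervals $[k,k+1]$, $k\in\mathbb Z$; $[\![S]\!]\subset\mathbf X$ is the set of points with $x\in\bigcup_{f\in S}\Psi(f)$. An $\mathfrak m$-graphing of support $V$ and finite stateset $D$ is a countable family of edges $e$, each with a measurable source $S_e\subseteq V$, input and output states in $D$, a realiser $\phi_e\in\mathfrak m$ with $\phi_e(S_e)\subseteq V$, and a weight in $\Omega$. A *machine* $M$ is an $\mathfrak n_\infty$-graphing of support $[\![\mathcal V]\!]$ with finitely many edges, each source being a product $S_e=A_e\times B_e$ with $A_e\subseteq\mathbb R\times[0,1]^{\mathbb N}$ and $B_e\subseteq\{\star,0,1\}^{\mathbb N}$ (the *stack test* of $e$). The *discrete graph* of a word $w=\star a_1\cdots a_k$ over $\{0,1\}$ ($a_0=\star$) has, for each position $i\in\{0,\dots,k\}$ (modulo $k+1$), an edge from $(a_i,\mathrm{Out})$ in state $i$ to $(a_{i+1},\mathrm{In})$ in state $i+1$ and one from $(a_i,\mathrm{In})$ in state $i$ to $(a_{i-1},\mathrm{Out})$ in state $i-1$. A *representation* $!W$ of $w$ is obtained by renaming positions by an injection $\iota$ into $\{0,\dots,K-1\}$ and letting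 an edge $(f,i)\to(g,j)$ act on the points of $[\![f]\!]$ whose first coordinate lies in $[\iota(i)/K,(\iota(i)+1)/K]$ by the translation taking $\Psi(f)$ to $\Psi(g)$ and the translation by $(\iota(j)-\iota(i))/K$ modulo $1$ of the first coordinate. For $N\ge1$, a *cell* is a pair of $f\in\mathcal V$ and an $N$-cube $\prod_{j<N}[\kappa_j/K,(\kappa_j+1)/K]$, seen as the set of points of $[\![f]\!]$ whose first $N$ coordinates lie in the cube. Let $\bar W$ be the (finite) graph on cells given by the discrete graph of $w$, position $i$ being read and written as $\kappa_0=\iota(i)$, the other $\kappa_j$ being unchanged, with all weights $(u,\varepsilon)$. A *thick graph* is a graph whose edges also have input and output control states. The *execution* of two graphings (or thick graphs) along a cut $C$ consists of the non-empty alternating paths between them, restricted to points (vertices) outside $C$ sent outside $C$; the states of one are not changed by the edges of the other. The computation of $M$ with $!W$ is their execution along $[\![\{0,1,\star\}\times\{\mathrm{In},\mathrm{Out}\}]\!]$. **Lemma.** Every machine $M$ is an $\mathfrak n_N$-graphing for some $N\ge1$. For every $N\ge 1$ such that $M$ is an $\mathfrak n_N$-graphing and every $K$, there are a finite $\Omega\times\Theta$-weighted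 thick graph $\bar M$ on the cells, with a finite stateset $\bar D$, a map $\mathrm{lab}$ from its edges to those of $M$, a map $\rho:\bar D\to D$, and for each $d\in D$ a measurable map $\mathrm{st}(\cdot,d):\mathbb R\times[0,1]^{\mathbb N}\to\rho^{-1}(d)$, such that: 1. an edge of $\bar M$ over an edge $e$ of $M$ has weight $(\omega_e,\theta)$, where $\theta$ acts on stacks as $\phi_e$ does; 2. for every cell $c$ and $\bar d\in\bar D$, the set of points of $c$ with $\mathrm{st}((x,s),\rho(\bar d))=\bar d$ has positive measure; 3. for every word $w$ and every injection $\iota$ of its positions into $\{0,\dots,K-1\}$, both for the computation of $M$ with $!W$ (and the execution of $\bar M$ and $\bar W$ along the corresponding set of cells), and for all alternating paths (empty cut), the following holds for almost every $z=(x,s,\pi)$, every cell $c\ni z$ and every $d\in D$: * every path $p$ of $M$ and $!W$ defined at $z$ in state $d$ lifts to a unique path $q$ of $\bar M$ and $\bar W$ over it (edge by edge, with initial and final states over those of $p$) that starts at $c$ in state $\mathrm{st}((x,s),d)$; * conversely, every path $q$ of $\bar M$ and $\bar W$ from $c$ in state $\mathrm{st}((x,s),d)$ lies over a unique alternating sequence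 $p$ of edges of $M$ and $!W$ with initial and final states, and $p$ is a path defined at $z$ if and only if the stack tests of the $M$-edges met along $q$ are passed, starting with the stack $\pi$ and letting it evolve according to the $\Theta$-weights of $q$. If no source of $M$ depends on the stack, $p$ is always defined at $z$; * if $q$ lies over $p$ as above, then $q$ has weight $(\omega_p,\theta)$ with $\omega_p$ the weight of $p$ and $\theta$ acting on stacks as the realiser $\phi_p$ of $p$ does everywhere; $\phi_p(z)=(x',s',\pi')$ lies in the final cell of $q$, and $q$ ends in the state $\mathrm{st}((x',s'),d')$, where $d'$ is the final state of $p$. -/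

import Mathlib

open Set MeasureTheory

noncomputable section

/-- The stack alphabet `{⋆, 0, 1}`. -/
inductive Letter
  | star
  | zero
  | one
  deriving DecidableEq

instance : Fintype Letter :=
  ⟨{Letter.star, Letter.zero, Letter.one}, by intro a; cases a <;> simp⟩

instance : MeasurableSpace Letter := ⊤

instance : Nonempty Letter := ⟨Letter.star⟩

/-- Infinite sequences `{⋆, 0, 1}^ℕ` (stacks, the top being the entry of index `0`). -/
abbrev Stack : Type := ℕ → Letter

/-- The space `ℝ × [0,1]^ℕ × {⋆,0,1}^ℕ`; its points are written `(x, s, π)`. -/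
abbrev Space : Type := ℝ × (ℕ → unitInterval) × Stack

/-- Lebesgue measure on `ℝ × [0,1]^ℕ`, and on stacks the measure giving weight `3^{-n}` to every
cylinder over a word of length `n`. -/
def spaceMeasure : Measure Space :=
  (volume : Measure ℝ).prod
    ((Measure.infinitePi fun _ : ℕ => (volume : Measure unitInterval)).prod
      (Measure.infinitePi fun _ : ℕ => (PMF.uniformOfFintype Letter).toMeasure))

/-! ### Stack operations and the monoid `Θ` -/

/-- `c·π ↦ π`. -/
def popStack (π : Stack) : Stack := fun n => π (n + 1)

/-- `π ↦ a·π`. -/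
def pushStack (a : Letter) (π : Stack) : Stack
  | 0 => a
  | n + 1 => π n

/-- Generators `0, 1, ⋆` (pushing a symbol) and `c` (popping) of `Θ`. -/
inductive ThetaGen
  | push (a : Letter)
  | pop

/-- The relations `c a = ε` for `a ∈ {0, 1, ⋆}`. -/
inductive ThetaRel : FreeMonoid ThetaGen → FreeMonoid ThetaGen → Prop
  | cancel (a : Letter) :
      ThetaRel (FreeMonoid.of ThetaGen.pop * FreeMonoid.of (ThetaGen.push a)) 1

/-- The monoid `Θ` generated by `{0, 1, ⋆, c}` with relations `c0 = c1 = c⋆ = ε`. -/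
abbrev Theta : Type := PresentedMonoid ThetaRel

/-- The map on stacks denoted by a generator of `Θ`. -/
def thetaGenAct : ThetaGen → Function.End Stack
  | ThetaGen.push a => pushStack a
  | ThetaGen.pop => popStack

theorem thetaGenAct_rel (a b : FreeMonoid ThetaGen) (h : ThetaRel a b) :
    FreeMonoid.lift thetaGenAct a = FreeMonoid.lift thetaGenAct b := by
  cases h with
  | cancel a =>
    rw [map_mul, FreeMonoid.lift_eval_of, FreeMonoid.lift_eval_of, map_one]
    rfl

/-- The stack operation encoded by an element of `Θ`. The product of `Θ` is the composition of
operations, the right factor being performed first. -/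
def thetaAct : Theta →* Function.End Stack :=
  PresentedMonoid.lift thetaGenAct thetaGenAct_rel

/-! ### Microcosms -/

/-- The translation `(x, s, π) ↦ (x + z, s, π)`. -/
def translMap (z : ℤ) : Function.End Space := fun p => (p.1 + z, p.2.1, p.2.2)

/-- The permutation `(x, s, π) ↦ (x, σ(s), π)`. -/
def permMap (σ : Equiv.Perm ℕ) : Function.End Space :=
  fun p => (p.1, fun k => p.2.1 (σ.symm k), p.2.2)

/-- `(x, s, c·π) ↦ (x, s, π)`. -/
def popMap : Function.End Space := fun p => (p.1, p.2.1, popStack p.2.2)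

/-- `(x, s, π) ↦ (x, s, a·π)`. -/
def pushMap (a : Letter) : Function.End Space := fun p => (p.1, p.2.1, pushStack a p.2.2)

/-- The microcosm `𝔪ᵢ`: integer translations, and permutations of the first `i` coordinates
(indexed by `0, …, i - 1`) of the sequences. -/
def mMicro (i : ℕ) : Submonoid (Function.End Space) :=
  Submonoid.closure
    (Set.range translMap ∪ {f | ∃ σ : Equiv.Perm ℕ, (∀ k, i ≤ k → σ k = k) ∧ f = permMap σ})

/-- The microcosm `𝔫ᵢ`: the extension of `𝔪ᵢ` by the stack operations. -/
def nMicro (i : ℕ) : Submonoid (Function.End Space) :=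
  Submonoid.closure ((mMicro i : Set (Function.End Space)) ∪ {popMap} ∪ Set.range pushMap)

/-- The microcosm `𝔫_∞`, the union of the `𝔫ᵢ`. -/
def nInfty : Set (Function.End Space) := {f | ∃ i : ℕ, 1 ≤ i ∧ f ∈ nMicro i}

/-! ### Graphings and thick graphs -/

/-- The data of an `Ω`-weighted graphing representative with stateset `D`. The source of the edge
`e` is `src e × {inS e}`, its realiser is `real e`, and its target lies in the state `outS e`. -/
structure Graphing (D Ω : Type) where
  E : Type
  src : E → Set Space
  inS : E → D
  outS : E → D
  real : E → Function.End Space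
  wt : E → Ω

/-- `G` is a graphing representative of support `V` in the microcosm `m`. -/
structure Graphing.IsGraphing {D Ω : Type} (m : Set (Function.End Space)) (V : Set Space)
    (G : Graphing D Ω) : Prop where
  countable : Countable G.E
  measurable : ∀ e, MeasurableSet (G.src e)
  src_subset : ∀ e, G.src e ⊆ V
  real_mem : ∀ e, G.real e ∈ m
  image_subset : ∀ e, G.real e '' G.src e ⊆ V

/-- An `Ω`-weighted thick graph over the vertices `V`: a graph whose edges also carry an input and
an output control state in the dialect `D`. -/
structure ThickGraph (V D Ω : Type) where
  E : Type
  src : E → V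
  tgt : E → V
  inS : E → D
  outS : E → D
  wt : E → Ω

/-! ### Alternating paths and execution -/

/-- A non-empty sequence of edges taken alternately in the two sides of a disjoint union. -/
def IsAlternating {α β : Type} (l : List (α ⊕ β)) : Prop :=
  l ≠ [] ∧ l.IsChain fun a b => a.isLeft ≠ b.isLeft

/-- The weight of a path; the factor of the last edge comes first, as for compositions. -/
def pathWt {α Ω : Type} [Monoid Ω] (wt : α → Ω) : List α → Ω
  | [] => 1
  | a :: l => pathWt wt l * wt a

section GraphingExec

variable {D D' Ω : Type}

/-- One step along an edge of `F` or of `G`, on points of `Space` with a state of `F` and a state of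
`G`. An edge of one graphing does not act on the state of the other. -/
def Graphing.Step (F : Graphing D Ω) (G : Graphing D' Ω) :
    F.E ⊕ G.E → Space × D × D' → Space × D × D' → Prop
  | Sum.inl e, p, q => p.1 ∈ F.src e ∧ p.2.1 = F.inS e ∧ q = (F.real e p.1, F.outS e, p.2.2)
  | Sum.inr e, p, q => p.1 ∈ G.src e ∧ p.2.2 = G.inS e ∧ q = (G.real e p.1, p.2.1, G.outS e)

/-- Following a sequence of edges of `F` and `G` leads from the first point to the second. -/
def Graphing.Run (F : Graphing D Ω) (G : Graphing D' Ω) :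
    List (F.E ⊕ G.E) → Space × D × D' → Space × D × D' → Prop
  | [], p, q => q = p
  | a :: l, p, q => ∃ r, Graphing.Step F G a p r ∧ Graphing.Run F G l r q

/-- The realiser of a path: the composition of the realisers of its edges. -/
def Graphing.pathReal (F : Graphing D Ω) (G : Graphing D' Ω) :
    List (F.E ⊕ G.E) → Function.End Space :=
  pathWt (Sum.elim F.real G.real)

/-- An alternating sequence of edges of `F` and `G`, with initial and final states. -/
structure Graphing.AltPath (F : Graphing D Ω) (G : Graphing D' Ω) where
  edges : List (F.E ⊕ G.E)
  alt : IsAlternating edges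
  source : D × D'
  target : D × D'

/-- The execution of `F` and `G` along the cut `C`: its edges are the alternating paths between
`F` and `G`, restricted to the points outside `C` that the path is defined at and sends outside `C`
(sequences of edges which do not compose have an empty source). For `C = ∅` one gets all the
alternating paths, without restriction. -/
def Graphing.exec [Monoid Ω] (F : Graphing D Ω) (G : Graphing D' Ω) (C : Set Space) :
    Graphing (D × D') Ω where
  E := Graphing.AltPath F G
  src p := {z | z ∉ C ∧ ∃ z', z' ∉ C ∧ Graphing.Run F G p.edges (z, p.source) (z', p.target)}
  inS p := p.source
  outS p := p.target
  real p := Graphing.pathReal F G p.edges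
  wt p := pathWt (Sum.elim F.wt G.wt) p.edges

end GraphingExec

section GraphExec

variable {V D D' Ω : Type}

/-- One step along an edge of one of two thick graphs, on vertices with a state of each. -/
def ThickGraph.Step (F : ThickGraph V D Ω) (G : ThickGraph V D' Ω) :
    F.E ⊕ G.E → V × D × D' → V × D × D' → Prop
  | Sum.inl e, p, q => p.1 = F.src e ∧ p.2.1 = F.inS e ∧ q = (F.tgt e, F.outS e, p.2.2)
  | Sum.inr e, p, q => p.1 = G.src e ∧ p.2.2 = G.inS e ∧ q = (G.tgt e, p.2.1, G.outS e)

/-- Following a sequence of edges leads from the first vertex-with-states to the second. -/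
def ThickGraph.Run (F : ThickGraph V D Ω) (G : ThickGraph V D' Ω) :
    List (F.E ⊕ G.E) → V × D × D' → V × D × D' → Prop
  | [], p, q => q = p
  | a :: l, p, q => ∃ r, ThickGraph.Step F G a p r ∧ ThickGraph.Run F G l r q

/-- An alternating path between two thick graphs with both ends outside the set `C`. -/
structure ThickGraph.AltPath (F : ThickGraph V D Ω) (G : ThickGraph V D' Ω) (C : Set V) where
  edges : List (F.E ⊕ G.E)
  alt : IsAlternating edges
  source : V × D × D'
  target : V × D × D'
  run : ThickGraph.Run F G edges source target
  source_notMem : source.1 ∉ C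
  target_notMem : target.1 ∉ C

/-- The execution of two thick graphs along the cut `C`. -/
def ThickGraph.exec [Monoid Ω] (F : ThickGraph V D Ω) (G : ThickGraph V D' Ω) (C : Set V) :
    ThickGraph V (D × D') Ω where
  E := ThickGraph.AltPath F G C
  src p := p.source.1
  tgt p := p.target.1
  inS p := p.source.2
  outS p := p.target.2
  wt p := pathWt (Sum.elim F.wt G.wt) p.edges

end GraphExec

/-! ### Words -/

/-- The two directions `In` and `Out`. -/
inductive Dir
  | inn
  | out

/-- The vertices `{0,1,⋆} × {In, Out}` together with `a` (accept) and `r` (reject). -/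
inductive VSig
  | ext (a : Letter) (d : Dir)
  | acc
  | rej

/-- The vertices `{0,1,⋆} × {In, Out}`. -/
def extSig : Set VSig := {v | ∃ a d, v = VSig.ext a d}

/-- The subset `⟦S⟧` of the space, where the vertex `v` is interpreted by the interval
`[Ψ v, Ψ v + 1]`. -/
def region (Ψ : VSig → ℤ) (S : Set VSig) : Set Space :=
  {z | ∃ v ∈ S, z.1 ∈ Icc (Ψ v : ℝ) (Ψ v + 1)}

/-- The letters `0, 1` as symbols. -/
def bitLetter : Bool → Letter
  | false => Letter.zero
  | true => Letter.one

/-- The letter `aᵢ` of the word `⋆ a₁ … a_k`, with `a₀ = ⋆`. -/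
def letterAt (w : List Bool) : Fin (w.length + 1) → Letter :=
  Fin.cons Letter.star fun i => bitLetter (w.get i)

/-- The labels `r` (move right) and `l` (move left) of the edges of word graphs. -/
inductive Move
  | r
  | l

/-- The discrete graph of the word `⋆ a₁ … a_k`, all edges having weight `u`. The positions
`i + 1` and `i - 1` are taken modulo `k + 1`. -/
def wordGraph {Ω : Type} (u : Ω) (w : List Bool) : ThickGraph VSig (Fin (w.length + 1)) Ω where
  E := Move × Fin (w.length + 1)
  src
    | (Move.r, i) => VSig.ext (letterAt w i) Dir.out
    | (Move.l, i) => VSig.ext (letterAt w i) Dir.inn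
  tgt
    | (Move.r, i) => VSig.ext (letterAt w (i + 1)) Dir.inn
    | (Move.l, i) => VSig.ext (letterAt w (i - 1)) Dir.out
  inS e := e.2
  outS
    | (Move.r, i) => i + 1
    | (Move.l, i) => i - 1
  wt _ := u

/-- The word graphing: every edge `(f, i) → (g, j)` of the word graph is realised by the translation
of `⟦f⟧` onto `⟦g⟧`. -/
def wordGraphing {Ω : Type} (Ψ : VSig → ℤ) (u : Ω) (w : List Bool) :
    Graphing (Fin (w.length + 1)) Ω where
  E := (wordGraph u w).E
  src e := region Ψ {(wordGraph u w).src e}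
  inS := (wordGraph u w).inS
  outS := (wordGraph u w).outS
  real e := translMap (Ψ ((wordGraph u w).tgt e) - Ψ ((wordGraph u w).src e))
  wt := (wordGraph u w).wt

/-- Renaming the states of a graphing. -/
def Graphing.rename {D D' Ω : Type} (f : D → D') (G : Graphing D Ω) : Graphing D' Ω :=
  { G with inS := fun e => f (G.inS e), outS := fun e => f (G.outS e) }

/-- Renaming the states of a thick graph. -/
def ThickGraph.rename {V D D' Ω : Type} (f : D → D') (G : ThickGraph V D Ω) : ThickGraph V D' Ω :=
  { G with inS := fun e => f (G.inS e), outS := fun e => f (G.outS e) }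

/-- The fractional part of `a + t`. -/
def barAdd (a : unitInterval) (t : ℝ) : unitInterval :=
  ⟨Int.fract ((a : ℝ) + t), Int.fract_nonneg _, (Int.fract_lt_one _).le⟩

/-- The sequence `a·s`. -/
def consSeq (a : unitInterval) (s : ℕ → unitInterval) : ℕ → unitInterval
  | 0 => a
  | n + 1 => s n

/-- The exponential `!G` of a graphing with `K` states: the state `i` is encoded by the interval
`[i/K, (i+1)/K]` of a new first coordinate, and a change of state from `i` to `j` by the translation
by `(j - i)/K` modulo `1` on it. -/
def Graphing.bang {K : ℕ} {Ω : Type} (G : Graphing (Fin K) Ω) : Graphing Unit Ω where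
  E := G.E
  src e := {z | (z.2.1 0 : ℝ) ∈ Icc ((G.inS e : ℝ) / K) (((G.inS e : ℝ) + 1) / K) ∧
    ((z.1, fun n => z.2.1 (n + 1), z.2.2) : Space) ∈ G.src e}
  inS _ := ()
  outS _ := ()
  real e := fun z =>
    let y := G.real e (z.1, fun n => z.2.1 (n + 1), z.2.2)
    (y.1, consSeq (barAdd (z.2.1 0) (((G.outS e : ℝ) - (G.inS e : ℝ)) / K)) y.2.1, y.2.2)
  wt := G.wt

/-- The representation `!W` of the word `w` given by a renaming `ι` of its positions. -/
def wordRep {Ω : Type} (Ψ : VSig → ℤ) (u : Ω) (w : List Bool) {K : ℕ}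
    (ι : Fin (w.length + 1) → Fin K) : Graphing Unit Ω :=
  ((wordGraphing Ψ u w).rename ι).bang

/-! ### Discretisation -/

/-- Vertices of the finite graphs: `(v, κ)` stands for the points of `⟦v⟧` whose first `N`
coordinates lie in the `N`-cube `∏ⱼ [κⱼ/K, (κⱼ+1)/K]`. -/
abbrev Cell (N K : ℕ) : Type := VSig × (Fin N → Fin K)

/-- The point `z` lies in the cell `c`. -/
def InCell (Ψ : VSig → ℤ) {N K : ℕ} (z : Space) (c : Cell N K) : Prop :=
  z ∈ region Ψ {c.1} ∧
    ∀ j : Fin N, (z.2.1 j : ℝ) ∈ Icc ((c.2 j : ℝ) / K) (((c.2 j : ℝ) + 1) / K)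

/-- A thick graph with `K` states acting on cells: the state is read in, and written to, the first
coordinate of the cube, and the other coordinates are left unchanged. -/
def ThickGraph.onCells {K : ℕ} {Ω : Type} (N : ℕ) [NeZero N] (G : ThickGraph VSig (Fin K) Ω) :
    ThickGraph (Cell N K) Unit Ω where
  E := {p : G.E × (Fin N → Fin K) // p.2 0 = G.inS p.1}
  src p := (G.src p.1.1, p.1.2)
  tgt p := (G.tgt p.1.1, Function.update p.1.2 0 (G.outS p.1.1))
  inS _ := ()
  outS _ := ()
  wt p := G.wt p.1.1

/-- The discrete graph of the word `w` (with positions renamed by `ι`), acting on cells. Its weights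
have the neutral element of `Θ` as second component. -/
def wordCells {Ω : Type} (u : Ω) (w : List Bool) {K : ℕ} (ι : Fin (w.length + 1) → Fin K)
    (N : ℕ) [NeZero N] : ThickGraph (Cell N K) Unit (Ω × Theta) :=
  ((wordGraph ((u, 1) : Ω × Theta) w).rename ι).onCells N

/-! ### Stack tests and the correspondence -/

/-- `S` is a product of a subset of `ℝ × [0,1]^ℕ` and a set of stacks. -/
def IsRect (S : Set Space) : Prop :=
  ∀ z ∈ S, ∀ z' ∈ S, ((z.1, z.2.1, z'.2.2) : Space) ∈ S

/-- The set of stacks on which the edge `e` may be taken. -/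
def Graphing.stackTest {D Ω : Type} (G : Graphing D Ω) (e : G.E) : Set Stack :=
  {π | ∃ x s, ((x, s, π) : Space) ∈ G.src e}

/-- No source depends on the stack. -/
def Graphing.StackBlind {D Ω : Type} (G : Graphing D Ω) : Prop :=
  ∀ e, ∀ z ∈ G.src e, ∀ π : Stack, ((z.1, z.2.1, π) : Space) ∈ G.src e

/-- Along a path of an `Ω × Θ`-weighted graph `F` and another one, started with the stack `π`, each
edge `e` of `F` meets a stack in `test e`; the stack evolves as prescribed by the weights of `F`. -/
def Passes {α β Ω : Type} (wt : α → Ω × Theta) (test : α → Set Stack) :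
    List (α ⊕ β) → Stack → Prop
  | [], _ => True
  | Sum.inl e :: l, π => π ∈ test e ∧ Passes wt test l (thetaAct (wt e).2 π)
  | Sum.inr _ :: l, π => Passes wt test l π

section Correspondence

variable {Ω : Type} [Monoid Ω] {D D' : Type} {N K : ℕ} [NeZero N]

/-- The edge of `!W` which an edge of the discrete word graph on cells lies over. -/
def wordLab (Ψ : VSig → ℤ) (u : Ω) (w : List Bool) (ι : Fin (w.length + 1) → Fin K)
    (e : (wordCells u w ι N).E) : (wordRep Ψ u w ι).E := e.1.1

/-- An edge `q` of the execution of `M'` and the discrete word graph lies over an edge `p` of the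
execution of `M` and `!W`: the two paths consist of corresponding edges, and have corresponding
initial and final states. -/
def LiesOver (Ψ : VSig → ℤ) (u : Ω) (w : List Bool) (ι : Fin (w.length + 1) → Fin K)
    {M : Graphing D Ω} {M' : ThickGraph (Cell N K) D' (Ω × Theta)} (lab : M'.E → M.E) (ρ : D' → D)
    {C : Set VSig} (q : (M'.exec (wordCells u w ι N) (Prod.fst ⁻¹' C)).E)
    (p : (M.exec (wordRep Ψ u w ι) (region Ψ C)).E) : Prop :=
  Graphing.AltPath.edges p =
      (ThickGraph.AltPath.edges q).map (Sum.map lab (wordLab Ψ u w ι)) ∧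
    (Graphing.AltPath.source p).1 = ρ (ThickGraph.AltPath.source q).2.1 ∧
    (Graphing.AltPath.target p).1 = ρ (ThickGraph.AltPath.target q).2.1

end Correspondence

end

/-!
A machine tests and moves three separate components of a point: the real number `x`, the sequence
`s` and the stack. A realiser of `M` translates `x` by an integer and permutes the first `N`
coordinates of `s` (`exists_normalMap_of_mem_nMicro`), while an edge of `!W` translates `x` by an
integer and the first coordinate of `s` by a multiple of `1/K` modulo `1`. If `x` and `s` avoid the
boundaries of the cells, the fractional part of `x` and the relative positions of the coordinates in
their subintervals of length `1/K` therefore survive (`normalMap_eq_movePt`,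
`wordRep_real_eq_movePt`), and only finitely many points of `ℝ × [0,1]^ℕ` can be reached from
`(x, s)`: the points `movePt Ψ c τ (x, s)`, for `c` a cell and `τ` a permutation of `N` coordinates.

The states of the finite graph record, next to a state of `M`, the *profile* of `(x, s)`:
for each of these finitely many points, which edges of `M` accept it. The profile does not depend on
the cell and a permutation acts on it by translation (`profile_movePt`), so that it can be updated
without knowledge of `(x, s)`; together with the current cell it says which edges may be taken as
far as `ℝ × [0,1]^ℕ` is concerned. As sources are rectangles, only the stack test remains.

Only profiles of positive measure are kept as states. The maps `movePt` pull null sets back to null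
sets (`quasiMeasurePreserving_movePt`); hence such a profile occurs with positive measure in every
cell (`Realised.pos_inCell`), its translates have positive measure too, and almost every point is
`Generic`. From a generic point, edges lift uniquely and project back (`exists_step_above`,
`step_above_unique`, `step_below`), and an induction extends this to paths.
-/

noncomputable section

/-! ### Null sets under changes of coordinates -/

/-- Changing one coordinate of an i.i.d. sequence by a map which pulls null sets back to null sets
pulls null sets of sequences back to null sets. -/
theorem quasiMeasurePreserving_update {X : Type*} [MeasurableSpace X] (μ : Measure X)
    [IsProbabilityMeasure μ] (j : ℕ) {g : X → X} (hg : Measure.QuasiMeasurePreserving g μ μ) :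
    Measure.QuasiMeasurePreserving (fun s : ℕ → X => Function.update s j (g (s j)))
      (Measure.infinitePi fun _ => μ) (Measure.infinitePi fun _ => μ) := by
  set P : Measure (ℕ → X) := Measure.infinitePi fun _ => μ
  -- `h` replaces the coordinate `j` of a sequence by an independent one; it preserves the measure and
  -- turns the change of coordinate `j` into a map of the first factor of a product.
  let h : X × (ℕ → X) → ℕ → X := fun p => Function.update p.2 j p.1
  have hm : Measurable h := by
    refine measurable_pi_lambda _ fun i => ?_
    by_cases hi : i = j
    · subst hi; simpa [h] using measurable_fst
    · simpa [h, hi, Function.comp_def] using (measurable_pi_apply i).comp measurable_snd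
  have hmap : (μ.prod P).map h = P := by
    refine Measure.eq_infinitePi _ fun t A hA => ?_
    rw [Measure.map_apply hm (.pi t.countable_toSet fun i _ => hA i)]
    have : h ⁻¹' (Set.pi t A) = (if j ∈ t then A j else univ) ×ˢ Set.pi (t.erase j : Finset ℕ) A := by
      ext ⟨a, s⟩
      simp only [h, mem_preimage, Set.mem_pi, Finset.mem_coe, mem_prod, Finset.mem_erase]
      constructor
      · intro H
        refine ⟨?_, fun i hi => ?_⟩
        · split_ifs with hj
          · simpa using H j hj
          · trivial
        · simpa [hi.1] using H i hi.2
      · rintro ⟨H1, H2⟩ i hi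
        by_cases hij : i = j
        · subst hij; simpa [hi] using H1
        · simpa [hij] using H2 i ⟨hij, hi⟩
    rw [this, Measure.prod_prod, Measure.infinitePi_pi _ fun i _ => hA i]
    split_ifs with hj
    · exact Finset.mul_prod_erase t (fun i => μ (A i)) hj
    · simp [Finset.erase_eq_of_notMem hj]
  have hG : Measurable fun s : ℕ → X => Function.update s j (g (s j)) := by
    have : (fun s : ℕ → X => Function.update s j (g (s j))) = h ∘ fun s => (g (s j), s) := rfl
    rw [this]
    exact hm.comp ((hg.measurable.comp (measurable_pi_apply j)).prodMk measurable_id)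
  refine ⟨hG, ?_⟩
  have hac : (μ.prod P).map (Prod.map g id) ≪ μ.prod P := by
    have := Measure.map_prod_map μ P hg.measurable measurable_id
    rw [← this, Measure.map_id]
    exact hg.absolutelyContinuous.prod (Measure.AbsolutelyContinuous.refl P)
  have key : P.map (fun s : ℕ → X => Function.update s j (g (s j))) =
      ((μ.prod P).map (Prod.map g id)).map h := by
    conv_lhs => rw [← hmap]
    rw [Measure.map_map hG hm, Measure.map_map hm (hg.measurable.prodMap measurable_id)]
    congr 1
    funext p
    simp [h]
  rw [key]
  exact (hac.map hm).trans hmap.absolutelyContinuous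

/-- Only finitely many coordinates may be changed: an infinite product of absolutely continuous
measures need not be absolutely continuous. -/
theorem quasiMeasurePreserving_map_coords {X : Type*} [MeasurableSpace X] (μ : Measure X)
    [IsProbabilityMeasure μ] {g : ℕ → X → X}
    (hg : ∀ j, Measure.QuasiMeasurePreserving (g j) μ μ) (n : ℕ) :
    Measure.QuasiMeasurePreserving (fun (s : ℕ → X) j => if j < n then g j (s j) else s j)
      (Measure.infinitePi fun _ => μ) (Measure.infinitePi fun _ => μ) := by
  induction n with
  | zero => simpa using! Measure.QuasiMeasurePreserving.id _
  | succ n ih =>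
    convert (quasiMeasurePreserving_update μ n (hg n)).comp ih using 1
    funext s j
    rcases lt_trichotomy j n with h | rfl | h
    · simp [h, h.ne, Nat.lt_succ_of_lt h]
    · simp
    · simp [h.ne', h.not_gt, show ¬ j < n + 1 by omega]

theorem quasiMeasurePreserving_fract_add (m : ℤ) :
    Measure.QuasiMeasurePreserving (fun x : ℝ => (m : ℝ) + Int.fract x) volume volume := by
  refine ⟨by fun_prop, Measure.AbsolutelyContinuous.mk fun A hA h0 => ?_⟩
  rw [Measure.map_apply (by fun_prop) hA]
  -- locally the map is a translation by one of countably many integers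
  refine measure_mono_null (t := ⋃ n : ℤ, (fun x : ℝ => x + ((m : ℝ) - n)) ⁻¹' A) ?_ ?_
  · intro x hx
    refine mem_iUnion.2 ⟨⌊x⌋, ?_⟩
    have : x + ((m : ℝ) - ⌊x⌋) = m + Int.fract x := by rw [Int.fract]; ring
    simpa only [mem_preimage, this] using hx
  · refine measure_iUnion_null fun n => ?_
    rw [measure_preimage_add_right, h0]

/-- The point of `[k/K, (k+1)/K]` which occupies the same relative position there as `a` does in
its own subinterval of length `1/K`. -/
def cellPt {K : ℕ} (k : Fin K) (a : unitInterval) : unitInterval :=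
  ⟨((k : ℕ) + Int.fract ((K : ℝ) * a)) / K, by
    have hK : (0 : ℝ) < K := by exact_mod_cast k.pos
    have hk : ((k : ℕ) : ℝ) + 1 ≤ K := by exact_mod_cast k.isLt
    have h0 := Int.fract_nonneg ((K : ℝ) * a)
    have h1 := Int.fract_lt_one ((K : ℝ) * a)
    refine ⟨by positivity, (div_le_one hK).2 (by linarith)⟩⟩

theorem measurable_cellPt {K : ℕ} (k : Fin K) : Measurable (cellPt k) := by
  refine Measurable.subtype_mk ?_
  fun_prop

theorem quasiMeasurePreserving_cellPt {K : ℕ} (k : Fin K) :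
    Measure.QuasiMeasurePreserving (cellPt k) volume volume := by
  have hK : (K : ℝ) ≠ 0 := by exact_mod_cast k.pos.ne'
  refine ⟨measurable_cellPt k, Measure.AbsolutelyContinuous.mk fun A hA h0 => ?_⟩
  rw [Measure.map_apply (measurable_cellPt k) hA]
  rw [unitInterval.volume_apply] at h0 ⊢
  refine measure_mono_null
    (t := ⋃ n : ℤ, (fun x : ℝ => x + (((k : ℕ) : ℝ) - n) / K) ⁻¹' (Subtype.val '' A)) ?_ ?_
  · rintro _ ⟨a, ha, rfl⟩
    refine mem_iUnion.2 ⟨⌊(K : ℝ) * a⌋, cellPt k a, ha, ?_⟩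
    simp only [cellPt, Int.fract]
    field_simp
    ring
  · refine measure_iUnion_null fun n => ?_
    rw [measure_preimage_add_right, h0]

/-- The part `ℝ × [0,1]^ℕ` of the space, on which `st` is defined. -/
abbrev Base : Type := ℝ × (ℕ → unitInterval)

/-- Lebesgue measure on `ℝ × [0,1]^ℕ`. -/
def baseMeasure : Measure Base :=
  (volume : Measure ℝ).prod (Measure.infinitePi fun _ : ℕ => (volume : Measure unitInterval))

instance : NeZero baseMeasure := ⟨by
  unfold baseMeasure
  intro h
  have := congrArg (fun m : Measure Base => m univ) h
  simp [← univ_prod_univ, Measure.prod_prod] at this⟩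

/-- The projection forgetting the stack. -/
def toBase (z : Space) : Base := (z.1, z.2.1)

theorem measurePreserving_toBase : MeasurePreserving toBase spaceMeasure baseMeasure := by
  refine ⟨by unfold toBase; fun_prop, ?_⟩
  unfold spaceMeasure baseMeasure
  have h := Measure.map_prod_map (volume : Measure ℝ)
    ((Measure.infinitePi fun _ : ℕ => (volume : Measure unitInterval)).prod
      (Measure.infinitePi fun _ : ℕ => (PMF.uniformOfFintype Letter).toMeasure))
    measurable_id measurable_fst
  rw [Measure.map_id, Measure.map_fst_prod, measure_univ, one_smul] at h
  exact h.symm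

/-! ### Permutations of the first coordinates -/

section Perm

variable {N : ℕ}

/-- The permutation of `ℕ` which acts as `τ` on `0, …, N - 1` and fixes the other integers. -/
def extPerm (τ : Equiv.Perm (Fin N)) : Equiv.Perm ℕ := τ.extendDomain Fin.equivSubtype

theorem extPerm_mul (τ σ : Equiv.Perm (Fin N)) : extPerm (τ * σ) = extPerm τ * extPerm σ :=
  (Equiv.Perm.extendDomain_mul _ _ _).symm

theorem extPerm_one : extPerm (1 : Equiv.Perm (Fin N)) = 1 := Equiv.Perm.extendDomain_one _

theorem extPerm_one_symm (j : ℕ) : (extPerm (1 : Equiv.Perm (Fin N))).symm j = j := by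
  rw [extPerm_one]; rfl

theorem extPerm_symm (τ : Equiv.Perm (Fin N)) : (extPerm τ).symm = extPerm τ⁻¹ :=
  Equiv.Perm.extendDomain_symm _ _

theorem extPerm_apply_fin (τ : Equiv.Perm (Fin N)) (j : Fin N) : extPerm τ j = τ j :=
  Equiv.Perm.extendDomain_apply_image τ Fin.equivSubtype j

theorem extPerm_apply_of_le (τ : Equiv.Perm (Fin N)) {j : ℕ} (h : N ≤ j) : extPerm τ j = j :=
  Equiv.Perm.extendDomain_apply_not_subtype _ _ (not_lt.2 h)

theorem exists_extPerm_eq (σ : Equiv.Perm ℕ) (h : ∀ k, N ≤ k → σ k = k) :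
    ∃ τ : Equiv.Perm (Fin N), extPerm τ = σ := by
  have hlt : ∀ k, k < N ↔ σ k < N := by
    intro k
    constructor
    · intro hk
      by_contra hc
      have := σ.injective (h _ (not_lt.1 hc))
      omega
    · intro hk
      by_contra hc
      rw [h k (not_lt.1 hc)] at hk
      exact hc hk
  refine ⟨⟨fun j => ⟨σ j, (hlt j).1 j.2⟩, fun j => ⟨σ.symm j, (hlt _).2 (by simp)⟩,
    fun j => by simp, fun j => by simp⟩, ?_⟩
  ext k
  rcases lt_or_ge k N with hk | hk
  · exact extPerm_apply_fin _ ⟨k, hk⟩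
  · rw [extPerm_apply_of_le _ hk, h k hk]

end Perm

/-! ### Normal forms in the microcosms -/

section Microcosm

theorem mMicro_mono {i j : ℕ} (h : i ≤ j) : mMicro i ≤ mMicro j := by
  refine Submonoid.closure_mono (union_subset_union_right _ ?_)
  rintro f ⟨σ, hσ, rfl⟩
  exact ⟨σ, fun k hk => hσ k (h.trans hk), rfl⟩

theorem nMicro_mono {i j : ℕ} (h : i ≤ j) : nMicro i ≤ nMicro j :=
  Submonoid.closure_mono (union_subset_union_left _ (union_subset_union_left _ (mMicro_mono h)))

theorem thetaAct_push (a : Letter) :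
    thetaAct (PresentedMonoid.of ThetaRel (ThetaGen.push a)) = pushStack a := by
  simp [thetaAct]; rfl

theorem thetaAct_pop : thetaAct (PresentedMonoid.of ThetaRel ThetaGen.pop) = popStack := by
  simp [thetaAct]; rfl

/-- The map translating `x` by `k`, permuting the first `N` coordinates by `σ` and acting on the
stack as `θ`. -/
def normalMap {N : ℕ} (k : ℤ) (σ : Equiv.Perm (Fin N)) (θ : Theta) : Function.End Space :=
  fun z => (z.1 + k, fun j => z.2.1 ((extPerm σ).symm j), thetaAct θ z.2.2)

theorem normalMap_one {N : ℕ} : normalMap 0 (1 : Equiv.Perm (Fin N)) 1 = 1 := by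
  funext z
  simp [normalMap, extPerm_one, Function.End.one_def]
  rfl

theorem normalMap_mul {N : ℕ} (k l : ℤ) (σ τ : Equiv.Perm (Fin N)) (θ η : Theta) :
    normalMap k σ θ * normalMap l τ η = normalMap (k + l) (σ * τ) (θ * η) := by
  funext z
  simp only [normalMap, Function.End.mul_def, extPerm_mul, map_mul, Function.comp]
  refine Prod.ext (by push_cast; ring) (Prod.ext rfl rfl)

/-- The three kinds of generators act on different components of the space, so that products of
them reduce to one translation, one permutation and one stack operation. -/
theorem exists_normalMap_of_mem_nMicro {N : ℕ} {f : Function.End Space} (hf : f ∈ nMicro N) :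
    ∃ (k : ℤ) (σ : Equiv.Perm (Fin N)) (θ : Theta), f = normalMap k σ θ := by
  let S : Submonoid (Function.End Space) :=
    { carrier := {f | ∃ (k : ℤ) (σ : Equiv.Perm (Fin N)) (θ : Theta), f = normalMap k σ θ}
      one_mem' := ⟨0, 1, 1, normalMap_one.symm⟩
      mul_mem' := by
        rintro _ _ ⟨k, σ, θ, rfl⟩ ⟨l, τ, η, rfl⟩
        exact ⟨_, _, _, normalMap_mul ..⟩ }
  suffices h : nMicro N ≤ S from h hf
  refine Submonoid.closure_le.2 ?_
  refine union_subset (union_subset ?_ ?_) ?_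
  · refine Submonoid.closure_le.2 (union_subset ?_ ?_)
    · rintro _ ⟨k, rfl⟩
      exact ⟨k, 1, 1, by funext z; simp [normalMap, translMap, extPerm_one]; rfl⟩
    · rintro _ ⟨σ, hσ, rfl⟩
      obtain ⟨τ, rfl⟩ := exists_extPerm_eq σ hσ
      exact ⟨0, τ, 1, by funext z; simp [normalMap, permMap]; rfl⟩
  · rintro _ rfl
    exact ⟨0, 1, PresentedMonoid.of ThetaRel ThetaGen.pop, by
      funext z; simp [normalMap, popMap, thetaAct_pop, extPerm_one_symm]⟩
  · rintro _ ⟨a, rfl⟩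
    exact ⟨0, 1, PresentedMonoid.of ThetaRel (ThetaGen.push a), by
      funext z; simp [normalMap, pushMap, thetaAct_push, extPerm_one_symm]⟩

theorem Graphing.IsGraphing.exists_nMicro {D Ω : Type} {M : Graphing D Ω} [Finite M.E] {V : Set Space}
    (hM : M.IsGraphing nInfty V) : ∃ N : ℕ, 1 ≤ N ∧ M.IsGraphing (nMicro N) V := by
  choose i _ hi using hM.real_mem
  obtain ⟨B, hB⟩ := (Set.finite_range i).bddAbove
  refine ⟨B + 1, by omega, ⟨hM.countable, hM.measurable, hM.src_subset, fun e => ?_,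
    hM.image_subset⟩⟩
  exact nMicro_mono ((hB ⟨e, rfl⟩).trans B.le_succ) (hi e)

end Microcosm

/-! ### Moving a point to another cell -/

instance : Finite VSig := by
  refine Finite.of_surjective
    (fun x : (Letter × Bool) ⊕ Bool => match x with
      | .inl (a, b) => VSig.ext a (if b then Dir.inn else Dir.out)
      | .inr b => if b then VSig.acc else VSig.rej) ?_
  rintro (⟨a, _ | _⟩ | _ | _)
  · exact ⟨.inl (a, true), rfl⟩
  · exact ⟨.inl (a, false), rfl⟩
  · exact ⟨.inr true, rfl⟩
  · exact ⟨.inr false, rfl⟩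

section Move

variable {N K : ℕ} (Ψ : VSig → ℤ)

/-- `InCell` as a property of the projection of a point to `ℝ × [0,1]^ℕ`. -/
def InCellBase (y : Base) (c : Cell N K) : Prop :=
  y.1 ∈ Icc (Ψ c.1 : ℝ) (Ψ c.1 + 1) ∧
    ∀ j : Fin N, (y.2 j : ℝ) ∈ Icc ((c.2 j : ℝ) / K) (((c.2 j : ℝ) + 1) / K)

theorem inCell_iff {z : Space} {c : Cell N K} : InCell Ψ z c ↔ InCellBase Ψ (toBase z) c := by
  simp [InCell, InCellBase, region, toBase]

/-- The point of the cell `c` having the fractional part of `x` and, up to the permutation `τ`, the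
relative positions of `s` in its cube. A generic point can only be sent to points of this form by
the edges of a machine and of a word representation. -/
def movePt (c : Cell N K) (τ : Equiv.Perm (Fin N)) (y : Base) : Base :=
  (Ψ c.1 + Int.fract y.1, fun j =>
    if h : j < N then cellPt (c.2 ⟨j, h⟩) (y.2 ((extPerm τ).symm j)) else y.2 ((extPerm τ).symm j))

theorem quasiMeasurePreserving_movePt (c : Cell N K) (τ : Equiv.Perm (Fin N)) :
    Measure.QuasiMeasurePreserving (movePt Ψ c τ) baseMeasure baseMeasure := by
  let P : Measure (ℕ → unitInterval) := Measure.infinitePi fun _ => volume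
  let g : ℕ → unitInterval → unitInterval := fun j =>
    if h : j < N then cellPt (c.2 ⟨j, h⟩) else id
  have hg : ∀ j, Measure.QuasiMeasurePreserving (g j) volume volume := by
    intro j
    by_cases h : j < N
    · simpa [g, h] using quasiMeasurePreserving_cellPt _
    · simpa [g, h] using Measure.QuasiMeasurePreserving.id _
  have h1 := quasiMeasurePreserving_map_coords volume hg N
  have h2 : Measure.QuasiMeasurePreserving
      (fun (s : ℕ → unitInterval) j => s ((extPerm τ).symm j)) P P :=
    ⟨by fun_prop, (Measure.map_infinitePi_infinitePi_of_inj
      (extPerm τ).symm.injective).absolutelyContinuous⟩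
  have h3 := h1.comp h2
  have h4 := quasiMeasurePreserving_fract_add (Ψ c.1)
  have h5 : movePt Ψ c τ = Prod.map (fun x : ℝ => (Ψ c.1 : ℝ) + Int.fract x)
      ((fun (s : ℕ → unitInterval) j => if j < N then g j (s j) else s j) ∘
        fun (s : ℕ → unitInterval) j => s ((extPerm τ).symm j)) := by
    funext y
    refine Prod.ext rfl (funext fun j => ?_)
    by_cases h : j < N <;> simp [movePt, g, h]
  rw [h5]
  refine ⟨h4.measurable.prodMap h3.measurable, ?_⟩
  unfold baseMeasure
  rw [← Measure.map_prod_map _ _ h4.measurable h3.measurable]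
  exact h4.absolutelyContinuous.prod h3.absolutelyContinuous

theorem fract_mul_cellPt (k : Fin K) (a : unitInterval) :
    Int.fract ((K : ℝ) * cellPt k a) = Int.fract ((K : ℝ) * a) := by
  have hK : (K : ℝ) ≠ 0 := by exact_mod_cast k.pos.ne'
  simp [cellPt, mul_div_cancel₀ _ hK]

theorem cellPt_cellPt (k l : Fin K) (a : unitInterval) : cellPt k (cellPt l a) = cellPt k a := by
  refine Subtype.ext ?_
  simp only [cellPt]
  rw [show (((l : ℕ) : ℝ) + Int.fract ((K : ℝ) * a)) / K = cellPt l a from rfl, fract_mul_cellPt]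

theorem cellPt_mem (k : Fin K) (a : unitInterval) :
    (cellPt k a : ℝ) ∈ Icc (((k : ℕ) : ℝ) / K) ((((k : ℕ) : ℝ) + 1) / K) := by
  have h0 := Int.fract_nonneg ((K : ℝ) * a)
  have h1 := (Int.fract_lt_one ((K : ℝ) * a)).le
  exact ⟨by simp only [cellPt]; gcongr; linarith, by simp only [cellPt]; gcongr⟩

theorem movePt_movePt (c c' : Cell N K) (τ σ : Equiv.Perm (Fin N)) (y : Base) :
    movePt Ψ c τ (movePt Ψ c' σ y) = movePt Ψ c (τ * σ) y := by
  refine Prod.ext (by simp [movePt]) (funext fun j => ?_)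
  have hs : (extPerm (τ * σ)).symm j = (extPerm σ).symm ((extPerm τ).symm j) := by
    rw [extPerm_mul]; rfl
  by_cases h : j < N
  · have hj : (extPerm τ).symm j < N := by
      rw [extPerm_symm]
      simpa only [extPerm_apply_fin] using
        (extPerm_apply_fin τ⁻¹ ⟨j, h⟩ ▸ (τ⁻¹ ⟨j, h⟩).isLt : extPerm τ⁻¹ (⟨j, h⟩ : Fin N) < N)
    simp [movePt, h, hs, hj, cellPt_cellPt]
  · have hj : (extPerm τ).symm j = j := by
      rw [extPerm_symm, extPerm_apply_of_le _ (not_lt.1 h)]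
    simp only [movePt, h, hs, hj, dif_neg, not_false_eq_true]

theorem inCellBase_movePt (c : Cell N K) (τ : Equiv.Perm (Fin N)) (y : Base) :
    InCellBase Ψ (movePt Ψ c τ y) c := by
  refine ⟨⟨?_, ?_⟩, fun j => ?_⟩
  · simp [movePt]
  · simpa [movePt] using (Int.fract_lt_one y.1).le
  · simpa [movePt] using cellPt_mem _ _

/-- The point `y` lies on no boundary of a cell, hence in at most one cell. -/
structure Interior (N K : ℕ) (y : Base) : Prop where
  fst : Int.fract y.1 ≠ 0
  snd : ∀ j : Fin N, Int.fract ((K : ℝ) * y.2 j) ≠ 0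

theorem eq_add_fract_of_mem {x : ℝ} {m : ℤ} (h : x ∈ Icc (m : ℝ) (m + 1)) (hx : Int.fract x ≠ 0) :
    x = m + Int.fract x := by
  have hm : ⌊x⌋ = m := by
    rw [Int.floor_eq_iff]
    refine ⟨h.1, h.2.lt_of_ne ?_⟩
    rintro rfl
    exact hx (by simp)
  rw [← hm, Int.floor_add_fract]

theorem cellPt_eq_self {k : Fin K} {a : unitInterval}
    (h : (a : ℝ) ∈ Icc (((k : ℕ) : ℝ) / K) ((((k : ℕ) : ℝ) + 1) / K))
    (ha : Int.fract ((K : ℝ) * a) ≠ 0) : cellPt k a = a := by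
  have hK : (0 : ℝ) < K := by exact_mod_cast k.pos
  refine Subtype.ext ?_
  have := eq_add_fract_of_mem (x := K * a) (m := (k : ℕ))
    ⟨by have := (div_le_iff₀' hK).1 h.1; exact_mod_cast this,
     by have := (le_div_iff₀' hK).1 h.2; exact_mod_cast this⟩ ha
  simp only [cellPt]
  rw [div_eq_iff hK.ne', mul_comm (a : ℝ), this]
  simp

theorem movePt_one_eq_self {c : Cell N K} {y : Base} (hc : InCellBase Ψ y c)
    (hy : Interior N K y) : movePt Ψ c 1 y = y := by
  refine Prod.ext (eq_add_fract_of_mem hc.1 hy.fst).symm (funext fun j => ?_)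
  by_cases h : j < N
  · simpa [movePt, h, extPerm_one_symm] using cellPt_eq_self (hc.2 ⟨j, h⟩) (hy.snd ⟨j, h⟩)
  · simp [movePt, h, extPerm_one_symm]

variable {Ψ} in
theorem Interior.movePt {y : Base} (hy : Interior N K y) (c : Cell N K) (τ : Equiv.Perm (Fin N)) :
    Interior N K (movePt Ψ c τ y) := by
  refine ⟨by simpa [_root_.movePt] using hy.fst, fun j => ?_⟩
  have := hy.snd (τ⁻¹ j)
  simpa [_root_.movePt, fract_mul_cellPt, extPerm_symm, extPerm_apply_fin] using this

/-- For `K = 0` there are no cells, and no point satisfies the condition on the coordinates. -/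
theorem ae_interior (hK : K ≠ 0) : ∀ᵐ y ∂baseMeasure, Interior N K y := by
  have h1 : ∀ᵐ y ∂baseMeasure, Int.fract y.1 ≠ 0 := by
    have : ∀ᵐ x : ℝ, Int.fract x ≠ 0 := by
      refine ((countable_range ((↑) : ℤ → ℝ)).ae_notMem _).mono fun x hx h => hx ?_
      exact ⟨_, (Int.fract_eq_zero_iff.1 h).choose_spec⟩
    exact Measure.quasiMeasurePreserving_fst.ae this
  have h2 : ∀ j : Fin N, ∀ᵐ y ∂baseMeasure, Int.fract ((K : ℝ) * y.2 j) ≠ 0 := by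
    intro j
    have : ∀ᵐ a : unitInterval, Int.fract ((K : ℝ) * a) ≠ 0 := by
      have hc : {a : unitInterval | Int.fract ((K : ℝ) * a) = 0}.Countable := by
        refine (countable_range (fun n : ℤ => (n : ℝ) / K)).preimage_of_injOn
          Subtype.val_injective.injOn |>.mono ?_
        intro a ha
        obtain ⟨n, hn⟩ := Int.fract_eq_zero_iff.1 ha
        refine ⟨n, ?_⟩
        have : (K : ℝ) ≠ 0 := by exact_mod_cast hK
        simp only [hn]
        field_simp
      exact (hc.ae_notMem _).mono fun x hx h => hx h
    exact ((measurePreserving_eval_infinitePi (fun _ : ℕ => (volume : Measure unitInterval))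
      j).quasiMeasurePreserving.comp Measure.quasiMeasurePreserving_snd).ae this
  filter_upwards [h1, ae_all_iff.2 h2] with y hy hy' using ⟨hy, hy'⟩

end Move

/-! ### Profiles -/

section Profile

variable {D Ω : Type} {N K : ℕ}

/-- The test performed by the edge `e` on the component `ℝ × [0,1]^ℕ`. -/
def Graphing.baseTest (M : Graphing D Ω) (e : M.E) : Set Base :=
  {y | ∃ π : Stack, ((y.1, y.2, π) : Space) ∈ M.src e}

theorem Graphing.measurableSet_baseTest {M : Graphing D Ω} {e : M.E}
    (hm : MeasurableSet (M.src e)) (hr : IsRect (M.src e)) : MeasurableSet (M.baseTest e) := by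
  rcases (M.src e).eq_empty_or_nonempty with h | ⟨z, hz⟩
  · simp [Graphing.baseTest, h]
  · have : M.baseTest e = (fun y : Base => ((y.1, y.2, z.2.2) : Space)) ⁻¹' M.src e := by
      ext y
      exact ⟨fun ⟨π, hπ⟩ => hr _ hπ _ hz, fun h => ⟨_, h⟩⟩
    rw [this]
    exact hm.preimage (by fun_prop)

/-- A rectangular source is the product of its two tests. -/
theorem Graphing.mem_src_iff {M : Graphing D Ω} {e : M.E} (hr : IsRect (M.src e)) {z : Space}
    (hz : toBase z ∈ M.baseTest e) : z ∈ M.src e ↔ z.2.2 ∈ M.stackTest e := by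
  refine ⟨fun h => ⟨_, _, h⟩, fun ⟨x, s, h⟩ => ?_⟩
  obtain ⟨π, hπ⟩ := hz
  exact hr _ hπ (x, s, z.2.2) h

/-- For each of the points obtained from a given one by `movePt`, the set of edges whose test on
`ℝ × [0,1]^ℕ` it satisfies. -/
abbrev Profile (N K : ℕ) (E : Type) : Type := Cell N K → Equiv.Perm (Fin N) → Set E

/-- The effect on profiles of permuting coordinates by `σ`, see `profile_movePt`. -/
def Profile.act {E : Type} (t : Profile N K E) (σ : Equiv.Perm (Fin N)) : Profile N K E :=
  fun c τ => t c (τ * σ)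

theorem Profile.act_one {E : Type} (t : Profile N K E) : t.act 1 = t := by
  funext c τ
  simp [Profile.act]

variable (Ψ : VSig → ℤ) (M : Graphing D Ω)

/-- The profile of a point: all that the edges of `M` may ever learn about it, except for the cell
which is currently occupied. -/
def profile (y : Base) : Profile N K M.E := fun c τ => {e | movePt Ψ c τ y ∈ M.baseTest e}

/-- The profile does not depend on the cell, and is permuted along with the coordinates. -/
theorem profile_movePt (c : Cell N K) (σ : Equiv.Perm (Fin N)) (y : Base) :
    profile Ψ M (movePt Ψ c σ y) = (profile Ψ M y : Profile N K M.E).act σ := by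
  funext c' τ
  simp only [profile, Profile.act, movePt_movePt]

instance [Finite M.E] : Finite (Profile N K M.E) := by
  unfold Profile; infer_instance

variable {M} in
theorem measurableSet_profile_eq [Finite M.E] (hm : ∀ e, MeasurableSet (M.src e))
    (hr : ∀ e, IsRect (M.src e)) (t : Profile N K M.E) :
    MeasurableSet {y | profile Ψ M y = t} := by
  have : {y | profile Ψ M y = t} =
      ⋂ (c : Cell N K) (τ : Equiv.Perm (Fin N)) (e : M.E),
        {y | movePt Ψ c τ y ∈ M.baseTest e ↔ e ∈ t c τ} := by
    ext y
    simp only [mem_ofPred_eq, mem_iInter, funext_iff, profile, Set.ext_iff]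
  rw [this]
  refine .iInter fun c => .iInter fun τ => .iInter fun e => ?_
  have h := (Graphing.measurableSet_baseTest (hm e) (hr e)).preimage
    (quasiMeasurePreserving_movePt Ψ c τ).measurable
  by_cases he : e ∈ t c τ
  · simpa only [he, iff_true] using! h
  · simpa only [he, iff_false] using! h.compl

/-- The profile `t` is that of a set of points of positive measure. -/
def Realised (t : Profile N K M.E) : Prop := 0 < baseMeasure {y | profile Ψ M y = t}

theorem Realised.act {t : Profile N K M.E} (ht : Realised Ψ M t) (c : Cell N K)
    (σ : Equiv.Perm (Fin N)) : Realised Ψ M (t.act σ) := by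
  refine pos_iff_ne_zero.2 fun h0 => ht.ne' ?_
  refine measure_mono_null (fun y hy => ?_)
    ((quasiMeasurePreserving_movePt Ψ c σ).preimage_null h0)
  rw [mem_preimage, mem_ofPred_eq, profile_movePt, show profile Ψ M y = t from hy]

/-- A realised profile occurs with positive measure in every cell: since `movePt` leaves profiles
unchanged, a null set of such points in `c` would pull back to a null set of all such points. -/
theorem Realised.pos_inCell {t : Profile N K M.E} (ht : Realised Ψ M t) (c : Cell N K) :
    0 < baseMeasure {y | InCellBase Ψ y c ∧ profile Ψ M y = t} := by
  refine pos_iff_ne_zero.2 fun h0 => ht.ne' ?_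
  refine measure_mono_null (fun y hy => ?_)
    ((quasiMeasurePreserving_movePt Ψ c 1).preimage_null h0)
  refine ⟨inCellBase_movePt Ψ c 1 y, ?_⟩
  rw [profile_movePt, show profile Ψ M y = t from hy, Profile.act_one]

theorem ae_realised [Finite M.E] : ∀ᵐ y ∂baseMeasure, Realised Ψ M (profile Ψ M y : Profile N K M.E) := by
  have h : ∀ t : Profile N K M.E, ¬ Realised Ψ M t →
      ∀ᵐ y ∂baseMeasure, profile Ψ M y ≠ t := by
    intro t ht
    rw [ae_iff]
    simpa [Realised] using ht
  have h2 : ∀ t : Profile N K M.E, ∀ᵐ y ∂baseMeasure, ¬ Realised Ψ M t → profile Ψ M y ≠ t :=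
    fun t => by
      by_cases ht : Realised Ψ M t
      · simp [ht]
      · simpa [ht] using h t ht
  filter_upwards [ae_all_iff.2 h2] with y hy
  by_contra hc
  exact hy _ hc rfl

variable (N K) in
/-- The profiles occurring with positive measure, of which there is at least one. -/
abbrev RealisedProfile : Type := {t : Profile N K M.E // Realised Ψ M t}

instance [Finite M.E] : Nonempty (RealisedProfile N K Ψ M) :=
  let ⟨y, hy⟩ := (ae_realised (N := N) (K := K) Ψ M).exists
  ⟨⟨profile Ψ M y, hy⟩⟩

/-- The points for which the finite graphs are a faithful description: they lie on no boundary of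
a cell, and their profile is realised. This is preserved along paths. -/
structure Generic (N K : ℕ) (y : Base) : Prop where
  interior : Interior N K y
  realised : Realised Ψ M (profile Ψ M y : Profile N K M.E)

variable {Ψ M} in
theorem Generic.movePt {y : Base} (hy : Generic Ψ M N K y) (c : Cell N K)
    (σ : Equiv.Perm (Fin N)) : Generic Ψ M N K (movePt Ψ c σ y) :=
  ⟨hy.interior.movePt c σ, by rw [profile_movePt]; exact hy.realised.act Ψ M c σ⟩

variable [Finite M.E]

open Classical in
/-- The profile `t` itself if it is realised, and an arbitrary realised profile otherwise (which
happens for the profiles of a null set of points only). -/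
def normalise (t : Profile N K M.E) : RealisedProfile N K Ψ M :=
  if h : Realised Ψ M t then ⟨t, h⟩ else Classical.arbitrary _

theorem normalise_coe (t : RealisedProfile N K Ψ M) : normalise Ψ M t.1 = t := by
  simp [normalise, t.2]

theorem normalise_val {t : Profile N K M.E} (h : Realised Ψ M t) : (normalise Ψ M t).1 = t := by
  simp [normalise, h]

/-- The state of the finite graph which describes the point `y` in the state `d`. -/
def stateAt (y : Base) (d : D) : D × RealisedProfile N K Ψ M := (d, normalise Ψ M (profile Ψ M y))

theorem stateAt_movePt (c : Cell N K) (σ : Equiv.Perm (Fin N)) (y : Base) (d : D) :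
    (stateAt Ψ M (movePt Ψ c σ y) d : D × RealisedProfile N K Ψ M) =
      (d, normalise Ψ M ((profile Ψ M y).act σ)) := by
  rw [stateAt, profile_movePt]

variable {M} in
theorem measurableSet_stateAt_eq (hm : ∀ e, MeasurableSet (M.src e))
    (hr : ∀ e, IsRect (M.src e)) (d : D) (d' : D × RealisedProfile N K Ψ M) :
    MeasurableSet {y | stateAt Ψ M y d = d'} := by
  have : {y | stateAt Ψ M y d = d'} = ⋃ t : {t : Profile N K M.E // (d, normalise Ψ M t) = d'},
      {y | profile Ψ M y = t.1} := by
    ext y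
    simp [stateAt]
  rw [this]
  exact .iUnion fun t => measurableSet_profile_eq Ψ hm hr _

theorem measurableSet_inCellBase (c : Cell N K) : MeasurableSet {y | InCellBase Ψ y c} := by
  have : {y | InCellBase Ψ y c} = (Prod.fst ⁻¹' Icc (Ψ c.1 : ℝ) (Ψ c.1 + 1)) ∩
      ⋂ j : Fin N, (fun y : Base => (y.2 j : ℝ)) ⁻¹'
        Icc ((c.2 j : ℝ) / K) (((c.2 j : ℝ) + 1) / K) := by
    ext y
    simp [InCellBase]
  rw [this]
  exact (measurableSet_Icc.preimage measurable_fst).inter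
    (.iInter fun j => measurableSet_Icc.preimage (by fun_prop))

variable {M} in
theorem stateAt_pos (hm : ∀ e, MeasurableSet (M.src e)) (hr : ∀ e, IsRect (M.src e))
    (c : Cell N K) (d' : D × RealisedProfile N K Ψ M) :
    0 < spaceMeasure {z | InCell Ψ z c ∧ stateAt Ψ M (toBase z) d'.1 = d'} := by
  have h : {z | InCell Ψ z c ∧ stateAt Ψ M (toBase z) d'.1 = d'} =
      toBase ⁻¹' ({y | InCellBase Ψ y c} ∩ {y | stateAt Ψ M y d'.1 = d'}) := by
    ext z
    simp [inCell_iff]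
  rw [h, measurePreserving_toBase.measure_preimage
    ((measurableSet_inCellBase Ψ c).inter
      (measurableSet_stateAt_eq Ψ hm hr _ _)).nullMeasurableSet]
  refine (d'.2.2.pos_inCell Ψ M c).trans_le (measure_mono ?_)
  rintro y ⟨hy, ht⟩
  exact ⟨hy, Prod.ext rfl (by simp only [stateAt]; rw [ht, normalise_coe])⟩

theorem ae_generic (hK : K ≠ 0) : ∀ᵐ z ∂spaceMeasure, Generic Ψ M N K (toBase z) := by
  refine measurePreserving_toBase.quasiMeasurePreserving.ae (p := Generic Ψ M N K) ?_
  filter_upwards [ae_interior hK, ae_realised Ψ M] with y h1 h2 using ⟨h1, h2⟩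

end Profile

/-! ### The finite thick graph of a machine -/

section CellGraph

variable {Ω D : Type} {N : ℕ} (K : ℕ) (Ψ : VSig → ℤ) (M : Graphing D Ω) [Finite M.E]
  (k : M.E → ℤ) (σ : M.E → Equiv.Perm (Fin N)) (θ : M.E → Theta)

/-- The finite thick graph of a machine `M` whose edge `e` is realised by
`normalMap (k e) (σ e) (θ e)`. Its edges are the tuples `(e, c, t, v)` such that points of profile
`t` in the cell `c` satisfy the test of `e` on `ℝ × [0,1]^ℕ` and are sent by `e` to points of
`⟦v⟧`. The target state is normalised only to have a realised profile by definition: `σ e` maps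
realised profiles to realised ones. -/
def cellGraph : ThickGraph (Cell N K) (D × RealisedProfile N K Ψ M) (Ω × Theta) where
  E := {a : M.E × Cell N K × RealisedProfile N K Ψ M × VSig //
    a.1 ∈ a.2.2.1.1 a.2.1 1 ∧ Ψ a.2.2.2 = Ψ a.2.1.1 + k a.1}
  src a := a.1.2.1
  tgt a := (a.1.2.2.2, fun j => a.1.2.1.2 ((σ a.1.1)⁻¹ j))
  inS a := (M.inS a.1.1, a.1.2.2.1)
  outS a := (M.outS a.1.1, normalise Ψ M (a.1.2.2.1.1.act (σ a.1.1)))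
  wt a := (M.wt a.1.1, θ a.1.1)

/-- The edge of `M` which an edge of `cellGraph` lies over. -/
def cellGraphLab (a : (cellGraph K Ψ M k σ θ).E) : M.E := a.1.1

instance : Finite (cellGraph K Ψ M k σ θ).E := by
  unfold cellGraph; infer_instance

end CellGraph

section Moves

variable {N K : ℕ} {Ψ : VSig → ℤ}

/-- On interior points of a cell, the elements of the microcosm are moves. -/
theorem normalMap_eq_movePt {y : Base} {c : Cell N K} (hc : InCellBase Ψ y c)
    (hy : Interior N K y) {v : VSig} {k : ℤ} (hv : Ψ v = Ψ c.1 + k) (σ : Equiv.Perm (Fin N)) :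
    ((y.1 + k, fun j => y.2 ((extPerm σ).symm j)) : Base) =
      movePt Ψ (v, fun j => c.2 (σ⁻¹ j)) σ y := by
  refine Prod.ext ?_ (funext fun j => ?_)
  · have := eq_add_fract_of_mem hc.1 hy.fst
    simp only [movePt, hv, Int.cast_add]
    linarith
  · by_cases h : j < N
    · have hs : (extPerm σ).symm j = σ⁻¹ ⟨j, h⟩ := by
        rw [extPerm_symm]; exact extPerm_apply_fin _ ⟨j, h⟩
      simp only [movePt, h, dif_pos, hs]
      exact (cellPt_eq_self (hc.2 _) (hy.snd _)).symm
    · simp [movePt, h]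

/-- The translation by `(j - i)/K` does not wrap around on the interior of `[i/K, (i+1)/K]`. -/
theorem barAdd_eq_cellPt {i j : Fin K} {a : unitInterval}
    (h : (a : ℝ) ∈ Icc (((i : ℕ) : ℝ) / K) ((((i : ℕ) : ℝ) + 1) / K))
    (ha : Int.fract ((K : ℝ) * a) ≠ 0) :
    barAdd a ((((j : ℕ) : ℝ) - ((i : ℕ) : ℝ)) / K) = cellPt j a := by
  have hK : (0 : ℝ) < K := by exact_mod_cast i.pos
  have hj : ((j : ℕ) : ℝ) + 1 ≤ K := by exact_mod_cast j.isLt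
  have h0 := Int.fract_nonneg ((K : ℝ) * a)
  have h1 := Int.fract_lt_one ((K : ℝ) * a)
  refine Subtype.ext ?_
  have ha' : (a : ℝ) = cellPt i a := by rw [cellPt_eq_self h ha]
  have : (a : ℝ) + (((j : ℕ) : ℝ) - ((i : ℕ) : ℝ)) / K = cellPt j a := by
    conv_lhs => rw [ha']
    simp only [cellPt]
    ring
  simp only [barAdd]
  rw [this, Int.fract_eq_self]
  refine ⟨(cellPt j a).2.1, ?_⟩
  simp only [cellPt]
  rw [div_lt_one hK]
  linarith

theorem eq_of_mem_Icc_fract {x : ℝ} {m n : ℤ} (hx : Int.fract x ≠ 0)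
    (hm : x ∈ Icc (m : ℝ) (m + 1)) (hn : x ∈ Icc (n : ℝ) (n + 1)) : m = n := by
  have h1 := eq_add_fract_of_mem hm hx
  have h2 := eq_add_fract_of_mem hn hx
  have : (m : ℝ) = n := by linarith
  exact_mod_cast this

theorem eq_of_mem_Icc_cell {a : unitInterval} {i j : Fin K} (ha : Int.fract ((K : ℝ) * a) ≠ 0)
    (hi : (a : ℝ) ∈ Icc (((i : ℕ) : ℝ) / K) ((((i : ℕ) : ℝ) + 1) / K))
    (hj : (a : ℝ) ∈ Icc (((j : ℕ) : ℝ) / K) ((((j : ℕ) : ℝ) + 1) / K)) : i = j := by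
  have h1 := congrArg Subtype.val (cellPt_eq_self hi ha)
  have h2 := congrArg Subtype.val (cellPt_eq_self hj ha)
  have hK : (K : ℝ) ≠ 0 := by exact_mod_cast i.pos.ne'
  simp only [cellPt] at h1 h2
  have h3 := h1.trans h2.symm
  rw [div_left_inj' hK, add_left_inj] at h3
  exact Fin.ext (by exact_mod_cast h3)

theorem mem_region_iff {C : Set VSig} (hΨ : Function.Injective Ψ) {z : Space} {c : Cell N K}
    (hz : Interior N K (toBase z)) (hc : InCell Ψ z c) : z ∈ region Ψ C ↔ c.1 ∈ C := by
  rw [inCell_iff] at hc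
  constructor
  · rintro ⟨v, hv, h⟩
    rwa [hΨ (eq_of_mem_Icc_fract hz.fst hc.1 h)]
  · exact fun h => ⟨_, h, hc.1⟩

variable [NeZero N] {Ω : Type} (u : Ω) (w : List Bool) (ι : Fin (w.length + 1) → Fin K)

/-- On interior points of a cell, the edges of `!W` are moves without permutation. -/
theorem wordRep_real_eq_movePt {z : Space} {c : Cell N K} (hc : InCell Ψ z c)
    (hz : Interior N K (toBase z)) (a : (wordCells u w ι N).E) (ha : c = (wordCells u w ι N).src a) :
    toBase ((wordRep Ψ u w ι).real (wordLab Ψ u w ι a) z) =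
      movePt Ψ ((wordCells u w ι N).tgt a) 1 (toBase z) := by
  rw [inCell_iff] at hc
  obtain ⟨⟨e, κ⟩, hκ⟩ := a
  subst ha
  have hκ' : κ 0 = ι ((wordGraph u w).inS e) := hκ
  refine Prod.ext ?_ (funext fun j => ?_)
  · have := eq_add_fract_of_mem hc.1 hz.fst
    change z.1 + ((Ψ ((wordGraph u w).tgt e) - Ψ ((wordGraph u w).src e) : ℤ) : ℝ) =
      Ψ ((wordGraph u w).tgt e) + Int.fract z.1
    have h2 : z.1 = Ψ ((wordGraph u w).src e) + Int.fract z.1 := this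
    push_cast
    linarith
  · rcases j with _ | j
    · have h1 := hc.2 0
      have h2 := hz.snd 0
      change barAdd (z.2.1 0) _ = _
      have hN : 0 < N := Nat.pos_of_ne_zero (NeZero.ne N)
      simp only [movePt, extPerm_one_symm, hN, dif_pos]
      have hu : ((wordCells u w ι N).tgt ⟨(e, κ), hκ⟩).2 ⟨0, hN⟩ = ι ((wordGraph u w).outS e) :=
        show Function.update κ 0 (ι ((wordGraph u w).outS e)) 0 = _ from Function.update_self ..
      rw [hu]
      refine barAdd_eq_cellPt ?_ h2
      have h3 : ((wordCells u w ι N).src ⟨(e, κ), hκ⟩).2 0 = ι ((wordGraph u w).inS e) := hκ'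
      rw [h3] at h1
      exact h1
    · change z.2.1 (j + 1) = _
      by_cases h : j + 1 < N
      · have hu : ((wordCells u w ι N).tgt ⟨(e, κ), hκ⟩).2 ⟨j + 1, h⟩ = κ ⟨j + 1, h⟩ := by
          change Function.update κ 0 (ι ((wordGraph u w).outS e)) ⟨j + 1, h⟩ = _
          refine Function.update_of_ne (fun h' => ?_) _ _
          have := congrArg Fin.val h'
          simp at this
        simp only [movePt, extPerm_one_symm, h, dif_pos]
        rw [hu]
        exact (cellPt_eq_self (hc.2 ⟨j + 1, h⟩) (hz.snd ⟨j + 1, h⟩)).symm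
      · simp [movePt, extPerm_one_symm, h, toBase]

end Moves

/-! ### Lifting edges -/

section Generalities

theorem isAlternating_map {α β α' β' : Type} (f : α → α') (g : β → β') (l : List (α ⊕ β)) :
    IsAlternating (l.map (Sum.map f g)) ↔ IsAlternating l := by
  simp [IsAlternating, List.isChain_map]

theorem passes_cons {α β Ω : Type} (wt : α → Ω × Theta) (wt' : β → Ω × Theta)
    (hwt : ∀ b, (wt' b).2 = 1) (test : α → Set Stack) (a : α ⊕ β) (l : List (α ⊕ β)) (π : Stack) :
    Passes wt test (a :: l) π ↔ Passes wt test [a] π ∧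
      Passes wt test l (thetaAct (Sum.elim wt wt' a).2 π) := by
  rcases a with e | e
  · simp [Passes]
  · simp only [Passes, true_and, Sum.elim_inr, hwt, map_one]
    rfl

end Generalities

section Steps

variable {Ω D : Type} {N K : ℕ} [NeZero N] {Ψ : VSig → ℤ} {M : Graphing D Ω} [Finite M.E]
  {k : M.E → ℤ} {σ : M.E → Equiv.Perm (Fin N)} {θ : M.E → Theta} {u : Ω} {w : List Bool}
  {ι : Fin (w.length + 1) → Fin K}

variable (k σ θ Ψ M u w ι) in
/-- The edge of `M` or `!W` which an edge of the finite graphs lies over. -/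
def edgeBelow : (cellGraph K Ψ M k σ θ).E ⊕ (wordCells u w ι N).E → M.E ⊕ (wordRep Ψ u w ι).E :=
  Sum.map (cellGraphLab K Ψ M k σ θ) (wordLab Ψ u w ι)

variable (k σ θ Ψ M u w ι) in
/-- The stack tests met along a sequence of edges of the finite graphs are passed. -/
def TestsPassed (l : List ((cellGraph K Ψ M k σ θ).E ⊕ (wordCells u w ι N).E)) (π : Stack) : Prop :=
  Passes (cellGraph K Ψ M k σ θ).wt (fun e => M.stackTest (cellGraphLab K Ψ M k σ θ e)) l π

variable (k σ θ Ψ M u w ι) in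
/-- The stack operation carried by an edge of the finite graphs. -/
def thetaOf (a : (cellGraph K Ψ M k σ θ).E ⊕ (wordCells u w ι N).E) : Theta :=
  (Sum.elim (cellGraph K Ψ M k σ θ).wt (wordCells u w ι N).wt a).2

variable (Ψ M u w ι) in
/-- The realiser of an edge of `M` or `!W`. -/
def realBelow (b : M.E ⊕ (wordRep Ψ u w ι).E) : Function.End Space :=
  Sum.elim M.real (wordRep Ψ u w ι).real b

theorem realBelow_stack (hreal : ∀ e, M.real e = normalMap (k e) (σ e) (θ e))
    (a : (cellGraph K Ψ M k σ θ).E ⊕ (wordCells u w ι N).E) (z : Space) :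
    (realBelow Ψ M u w ι (edgeBelow Ψ M k σ θ u w ι a) z).2.2 =
      thetaAct (thetaOf Ψ M k σ θ u w ι a) z.2.2 := by
  rcases a with a | a
  · change (M.real a.1.1 z).2.2 = thetaAct (θ a.1.1) z.2.2
    rw [hreal]; rfl
  · change _ = thetaAct 1 z.2.2
    rw [map_one]; rfl

/-- An edge of the finite graphs, taken from the vertex and state describing `(z, d)`, leads to
those describing the image `z'` of `z` in a state `d'`. The edge below it leads from `(z, d)` to
`(z', d')` and nowhere else, provided that the stack test is passed. -/
theorem step_below (hrect : ∀ e, IsRect (M.src e))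
    (hreal : ∀ e, M.real e = normalMap (k e) (σ e) (θ e))
    {a : (cellGraph K Ψ M k σ θ).E ⊕ (wordCells u w ι N).E} {z : Space} {c : Cell N K} {d : D}
    {r : Cell N K × (D × RealisedProfile N K Ψ M) × Unit}
    (hz : Generic Ψ M N K (toBase z)) (hc : InCell Ψ z c)
    (h : ThickGraph.Step (cellGraph K Ψ M k σ θ) (wordCells u w ι N) a
      (c, stateAt Ψ M (toBase z) d, ()) r)
    {z' : Space} (hz' : z' = realBelow Ψ M u w ι (edgeBelow Ψ M k σ θ u w ι a) z) :
    ∃ (c' : Cell N K) (d' : D), r = (c', stateAt Ψ M (toBase z') d', ()) ∧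
      Generic Ψ M N K (toBase z') ∧ InCell Ψ z' c' ∧
      (∀ s, Graphing.Step M (wordRep Ψ u w ι) (edgeBelow Ψ M k σ θ u w ι a) (z, d, ()) s ↔
        s = (z', d', ()) ∧ TestsPassed Ψ M k σ θ u w ι [a] z.2.2) ∧
      (M.StackBlind → TestsPassed Ψ M k σ θ u w ι [a] z.2.2) := by
  subst hz'
  have hcb := hc
  rw [inCell_iff] at hcb
  rcases a with a | a
  · obtain ⟨⟨e, c₁, t, v⟩, het, hv⟩ := a
    obtain ⟨h1, h2, rfl⟩ := h
    obtain rfl : c = c₁ := h1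
    obtain rfl : d = M.inS e := congrArg Prod.fst h2
    obtain rfl : normalise Ψ M (profile Ψ M (toBase z)) = t := congrArg Prod.snd h2
    have hmove : toBase (M.real e z) = movePt Ψ (v, fun j => c.2 ((σ e)⁻¹ j)) (σ e) (toBase z) := by
      rw [hreal, ← normalMap_eq_movePt hcb hz.interior hv]
      rfl
    have hbase : toBase z ∈ M.baseTest e := by
      have het' : e ∈ (normalise Ψ M (profile Ψ M (toBase z) : Profile N K M.E)).1 c 1 := het
      rw [normalise_val Ψ M hz.realised] at het'
      have : movePt Ψ c 1 (toBase z) ∈ M.baseTest e := het'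
      rwa [movePt_one_eq_self Ψ hcb hz.interior] at this
    have hsrc := Graphing.mem_src_iff (hrect e) hbase
    change ∃ c' d', _ = (c', stateAt Ψ M (toBase (M.real e z)) d', ()) ∧
      Generic Ψ M N K (toBase (M.real e z)) ∧ InCell Ψ (M.real e z) c' ∧ _
    refine ⟨(v, fun j => c.2 ((σ e)⁻¹ j)), M.outS e, ?_, ?_, ?_, ?_, ?_⟩
    · rw [hmove, stateAt_movePt]
      change ((v, fun j => c.2 ((σ e)⁻¹ j)), (M.outS e, normalise Ψ M ((normalise Ψ M _).1.act (σ e))), ()) = _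
      rw [normalise_val Ψ M hz.realised]
    · rw [hmove]; exact hz.movePt _ _
    · rw [inCell_iff, hmove]; exact inCellBase_movePt ..
    · intro s
      change (z ∈ M.src e ∧ _ ∧ _) ↔ (_ ∧ z.2.2 ∈ M.stackTest e ∧ True)
      rw [hsrc, and_true]
      exact ⟨fun h => ⟨h.2.2, h.1⟩, fun h => ⟨h.2, rfl, h.1⟩⟩
    · intro hb
      refine ⟨hsrc.1 ?_, trivial⟩
      obtain ⟨π, hπ⟩ := hbase
      exact hb e _ hπ z.2.2
  · obtain ⟨h1, h2, rfl⟩ := h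
    have h1' : c = (wordCells u w ι N).src a := h1
    have hmove := wordRep_real_eq_movePt (Ψ := Ψ) u w ι hc hz.interior a h1'
    change ∃ c' d', _ = (c', stateAt Ψ M (toBase
        ((wordRep Ψ u w ι).real (wordLab Ψ u w ι a) z)) d', ()) ∧
      Generic Ψ M N K (toBase ((wordRep Ψ u w ι).real (wordLab Ψ u w ι a) z)) ∧
      InCell Ψ ((wordRep Ψ u w ι).real (wordLab Ψ u w ι a) z) c' ∧ _
    refine ⟨(wordCells u w ι N).tgt a, d, ?_, ?_, ?_, ?_, fun _ => trivial⟩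
    · rw [hmove, stateAt_movePt, Profile.act_one]
      rfl
    · rw [hmove]; exact hz.movePt _ _
    · rw [inCell_iff, hmove]; exact inCellBase_movePt ..
    · intro s
      refine ⟨fun h => ⟨h.2.2, trivial⟩, fun h => ⟨?_, rfl, h.1⟩⟩
      subst h1'
      refine ⟨?_, ?_⟩
      · have := hcb.2 0
        have h3 : ((wordCells u w ι N).src a).2 0 = ι ((wordGraph u w).inS a.1.1) := a.2
        rw [h3] at this
        exact this
      · exact ⟨_, rfl, hcb.1⟩

/-- An edge of `M` or `!W` which may be taken at a generic point lifts to the finite graphs. -/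
theorem exists_step_above (hΨ : Function.Injective Ψ) (hM : M.IsGraphing (nMicro N) (region Ψ univ))
    (hreal : ∀ e, M.real e = normalMap (k e) (σ e) (θ e))
    {b : M.E ⊕ (wordRep Ψ u w ι).E} {z : Space} {c : Cell N K} {d : D}
    {r : Space × D × Unit}
    (hz : Generic Ψ M N K (toBase z)) (hc : InCell Ψ z c)
    (h : Graphing.Step M (wordRep Ψ u w ι) b (z, d, ()) r) :
    ∃ a r', edgeBelow Ψ M k σ θ u w ι a = b ∧
      ThickGraph.Step (cellGraph K Ψ M k σ θ) (wordCells u w ι N) a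
      (c, stateAt Ψ M (toBase z) d, ()) r' := by
  have hcb := hc
  rw [inCell_iff] at hcb
  rcases b with e | e
  · obtain ⟨h1, h2, rfl⟩ := h
    obtain rfl : d = M.inS e := h2
    have h1' : z ∈ M.src e := h1
    obtain ⟨v, -, hv⟩ := hM.image_subset e ⟨z, h1', rfl⟩
    -- the image of an interior point lies in the interior of an interval, which has to be `⟦v⟧`
    have hv' : Ψ v = Ψ c.1 + k e := by
      have hx : (M.real e z).1 = z.1 + k e := by rw [hreal]; rfl
      rw [hx] at hv
      refine eq_of_mem_Icc_fract (x := z.1 + k e) ?_ hv ?_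
      · rw [Int.fract_add_intCast]; exact hz.interior.fst
      · have := hcb.1
        push_cast
        constructor <;> simp only [toBase, mem_Icc] at this <;> linarith
    have hbase : e ∈ (normalise Ψ M (profile Ψ M (toBase z) : Profile N K M.E)).1 c 1 := by
      rw [normalise_val Ψ M hz.realised]
      change movePt Ψ c 1 (toBase z) ∈ M.baseTest e
      rw [movePt_one_eq_self Ψ hcb hz.interior]
      exact ⟨z.2.2, h1'⟩
    exact ⟨.inl ⟨(e, c, normalise Ψ M (profile Ψ M (toBase z)), v), hbase, hv'⟩, _, rfl,
      rfl, rfl, rfl⟩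
  · obtain ⟨h1, h2, rfl⟩ := h
    obtain ⟨h3, v, hv, h4⟩ := h1
    obtain rfl : v = (wordGraph u w).src e := hv
    have hc0 : c.2 0 = ι ((wordGraph u w).inS e) :=
      eq_of_mem_Icc_cell (hz.interior.snd 0) (hcb.2 0) h3
    have hc1 : c.1 = (wordGraph u w).src e :=
      hΨ (eq_of_mem_Icc_fract hz.interior.fst hcb.1 h4)
    exact ⟨.inr ⟨(e, c.2), hc0⟩, _, rfl, Prod.ext hc1 rfl, rfl, rfl⟩

/-- An edge is determined by its vertex and state of departure and by the edge below it. For the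
edges of `M` this uses that the target vertex is determined by the value of `Ψ`. -/
theorem step_above_unique (hΨ : Function.Injective Ψ)
    {a b : (cellGraph K Ψ M k σ θ).E ⊕ (wordCells u w ι N).E}
    {p r s : Cell N K × (D × RealisedProfile N K Ψ M) × Unit}
    (hab : edgeBelow Ψ M k σ θ u w ι a = edgeBelow Ψ M k σ θ u w ι b)
    (ha : ThickGraph.Step (cellGraph K Ψ M k σ θ) (wordCells u w ι N) a p r)
    (hb : ThickGraph.Step (cellGraph K Ψ M k σ θ) (wordCells u w ι N) b p s) : a = b ∧ r = s := by
  have key : a = b := by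
    rcases a with a | a <;> rcases b with b | b
    · obtain ⟨⟨e, c, t, v⟩, het, hv⟩ := a
      obtain ⟨⟨e', c', t', v'⟩, het', hv'⟩ := b
      obtain ⟨h1, h2, rfl⟩ := ha
      obtain ⟨h1', h2', rfl⟩ := hb
      obtain rfl : e = e' := Sum.inl_injective hab
      obtain rfl : c = c' := h1.symm.trans h1'
      obtain rfl : t = t' := congrArg Prod.snd (h2.symm.trans h2')
      obtain rfl : v = v' := hΨ (hv.trans hv'.symm)
      rfl
    · exact absurd hab (by simp [edgeBelow])
    · exact absurd hab (by simp [edgeBelow])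
    · obtain ⟨⟨e, κ⟩, he⟩ := a
      obtain ⟨⟨e', κ'⟩, he'⟩ := b
      obtain ⟨h1, h2, rfl⟩ := ha
      obtain ⟨h1', h2', rfl⟩ := hb
      obtain rfl : e = e' := Sum.inr_injective hab
      obtain rfl : κ = κ' := congrArg Prod.snd (h1.symm.trans h1')
      rfl
  refine ⟨key, ?_⟩
  subst key
  rcases a with a | a
  · exact ha.2.2.trans hb.2.2.symm
  · exact ha.2.2.trans hb.2.2.symm

end Steps

/-! ### Lifting paths -/

section Runs

variable {Ω D : Type} {N K : ℕ} [NeZero N] {Ψ : VSig → ℤ} {M : Graphing D Ω} [Finite M.E]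
  {k : M.E → ℤ} {σ : M.E → Equiv.Perm (Fin N)} {θ : M.E → Theta} {u : Ω} {w : List Bool}
  {ι : Fin (w.length + 1) → Fin K}

theorem pathReal_stack [Monoid Ω] (hreal : ∀ e, M.real e = normalMap (k e) (σ e) (θ e))
    (l : List ((cellGraph K Ψ M k σ θ).E ⊕ (wordCells u w ι N).E)) (z : Space) :
    (Graphing.pathReal M (wordRep Ψ u w ι) (l.map (edgeBelow Ψ M k σ θ u w ι)) z).2.2 =
      thetaAct (pathWt (Sum.elim (cellGraph K Ψ M k σ θ).wt (wordCells u w ι N).wt) l).2 z.2.2 := by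
  induction l generalizing z with
  | nil => change z.2.2 = thetaAct 1 z.2.2; rw [map_one]; rfl
  | cons a l ih =>
    change (Graphing.pathReal M (wordRep Ψ u w ι) (l.map (edgeBelow Ψ M k σ θ u w ι))
      (realBelow Ψ M u w ι (edgeBelow Ψ M k σ θ u w ι a) z)).2.2 = _
    rw [ih, realBelow_stack hreal]
    simp only [pathWt, Prod.snd_mul, map_mul]
    rfl

theorem pathWt_fst [Monoid Ω] (l : List ((cellGraph K Ψ M k σ θ).E ⊕ (wordCells u w ι N).E)) :
    (pathWt (Sum.elim (cellGraph K Ψ M k σ θ).wt (wordCells u w ι N).wt) l).1 =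
      pathWt (Sum.elim M.wt (wordRep Ψ u w ι).wt) (l.map (edgeBelow Ψ M k σ θ u w ι)) := by
  induction l with
  | nil => rfl
  | cons a l ih =>
    simp only [pathWt, List.map_cons, Prod.fst_mul, ih]
    rcases a with a | a <;> rfl

/-- The extension of `step_below` to sequences of edges. The point `z'` is defined even if some
stack test fails, as the realisers are total. -/
theorem run_below (hrect : ∀ e, IsRect (M.src e))
    (hreal : ∀ e, M.real e = normalMap (k e) (σ e) (θ e))
    {l : List ((cellGraph K Ψ M k σ θ).E ⊕ (wordCells u w ι N).E)} {z : Space} {c : Cell N K} {d : D}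
    {r : Cell N K × (D × RealisedProfile N K Ψ M) × Unit}
    (hz : Generic Ψ M N K (toBase z)) (hc : InCell Ψ z c)
    (h : ThickGraph.Run (cellGraph K Ψ M k σ θ) (wordCells u w ι N) l
      (c, stateAt Ψ M (toBase z) d, ()) r)
    {z' : Space}
    (hz' : z' = Graphing.pathReal M (wordRep Ψ u w ι) (l.map (edgeBelow Ψ M k σ θ u w ι)) z) :
    ∃ (c' : Cell N K) (d' : D), r = (c', stateAt Ψ M (toBase z') d', ()) ∧
      Generic Ψ M N K (toBase z') ∧ InCell Ψ z' c' ∧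
      (∀ s, Graphing.Run M (wordRep Ψ u w ι) (l.map (edgeBelow Ψ M k σ θ u w ι)) (z, d, ()) s ↔
        s = (z', d', ()) ∧ TestsPassed Ψ M k σ θ u w ι l z.2.2) ∧
      (M.StackBlind → TestsPassed Ψ M k σ θ u w ι l z.2.2) := by
  induction l generalizing z c d with
  | nil =>
    obtain rfl : z' = z := hz'
    obtain rfl := h
    exact ⟨c, d, rfl, hz, hc, fun s => (and_iff_left trivial).symm, fun _ => trivial⟩
  | cons a l ih =>
    obtain ⟨s, hs, h⟩ := h
    obtain ⟨c₁, d₁, rfl, hz₁, hc₁, hstep, hblind⟩ := step_below hrect hreal hz hc hs rfl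
    obtain ⟨c', d', hr, hzz, hcc, hrun, hblind'⟩ := ih hz₁ hc₁ h hz'
    have hpass : TestsPassed Ψ M k σ θ u w ι (a :: l) z.2.2 ↔
        TestsPassed Ψ M k σ θ u w ι [a] z.2.2 ∧ TestsPassed Ψ M k σ θ u w ι l
          (realBelow Ψ M u w ι (edgeBelow Ψ M k σ θ u w ι a) z).2.2 := by
      rw [realBelow_stack hreal]
      exact passes_cons _ (wordCells u w ι N).wt (fun _ => rfl) _ a l z.2.2
    refine ⟨c', d', hr, hzz, hcc, ?_, fun hb => hpass.2 ⟨hblind hb, hblind' hb⟩⟩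
    intro s
    constructor
    · rintro ⟨s₁, hs₁, hl⟩
      obtain ⟨rfl, ha⟩ := (hstep s₁).1 hs₁
      obtain ⟨rfl, hp⟩ := (hrun s).1 hl
      exact ⟨rfl, hpass.2 ⟨ha, hp⟩⟩
    · rintro ⟨rfl, h⟩
      exact ⟨_, (hstep _).2 ⟨rfl, (hpass.1 h).1⟩, (hrun _).2 ⟨rfl, (hpass.1 h).2⟩⟩

theorem exists_run_above (hΨ : Function.Injective Ψ) (hM : M.IsGraphing (nMicro N) (region Ψ univ))
    (hrect : ∀ e, IsRect (M.src e))
    (hreal : ∀ e, M.real e = normalMap (k e) (σ e) (θ e))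
    {m : List (M.E ⊕ (wordRep Ψ u w ι).E)} {z : Space} {c : Cell N K} {d : D}
    {r : Space × D × Unit}
    (hz : Generic Ψ M N K (toBase z)) (hc : InCell Ψ z c)
    (h : Graphing.Run M (wordRep Ψ u w ι) m (z, d, ()) r) :
    ∃ l r', l.map (edgeBelow Ψ M k σ θ u w ι) = m ∧
      ThickGraph.Run (cellGraph K Ψ M k σ θ) (wordCells u w ι N) l
        (c, stateAt Ψ M (toBase z) d, ()) r' := by
  induction m generalizing z c d with
  | nil => exact ⟨[], _, rfl, rfl⟩
  | cons b m ih =>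
    obtain ⟨s, hs, h⟩ := h
    obtain ⟨a, r₁, rfl, ha⟩ := exists_step_above hΨ hM hreal hz hc hs
    obtain ⟨c₁, d₁, rfl, hz₁, hc₁, hstep, -⟩ := step_below hrect hreal hz hc ha rfl
    obtain ⟨rfl, -⟩ := (hstep s).1 hs
    obtain ⟨l, r', rfl, hl⟩ := ih hz₁ hc₁ h
    exact ⟨a :: l, r', rfl, _, ha, hl⟩

theorem run_above_unique (hΨ : Function.Injective Ψ)
    {l m : List ((cellGraph K Ψ M k σ θ).E ⊕ (wordCells u w ι N).E)}
    {p r s : Cell N K × (D × RealisedProfile N K Ψ M) × Unit}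
    (h : l.map (edgeBelow Ψ M k σ θ u w ι) = m.map (edgeBelow Ψ M k σ θ u w ι))
    (hl : ThickGraph.Run (cellGraph K Ψ M k σ θ) (wordCells u w ι N) l p r)
    (hm : ThickGraph.Run (cellGraph K Ψ M k σ θ) (wordCells u w ι N) m p s) : l = m ∧ r = s := by
  induction l generalizing m p with
  | nil =>
    obtain rfl : m = [] := by simpa using h.symm
    exact ⟨rfl, Eq.trans hl (Eq.symm hm)⟩
  | cons a l ih =>
    rcases m with _ | ⟨b, m⟩
    · simp at h
    obtain ⟨p₁, ha, hl⟩ := hl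
    obtain ⟨p₂, hb, hm⟩ := hm
    rw [List.map_cons, List.map_cons, List.cons.injEq] at h
    obtain ⟨rfl, rfl⟩ := step_above_unique hΨ h.1 ha hb
    obtain ⟨rfl, rfl⟩ := ih h.2 hl hm
    exact ⟨rfl, rfl⟩

end Runs

end

theorem mainTheorem9 {Ω : Type} [Monoid Ω] (u : Ω) (Ψ : VSig → ℤ) (hΨ : Function.Injective Ψ)
    {D : Type} [Finite D] (M : Graphing D Ω) (hfin : Finite M.E)
    (hM : M.IsGraphing nInfty (region Ψ univ)) (hrect : ∀ e, IsRect (M.src e)) :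
    (∃ N : ℕ, 1 ≤ N ∧ M.IsGraphing (nMicro N) (region Ψ univ)) ∧
    ∀ (N K : ℕ) [NeZero N], M.IsGraphing (nMicro N) (region Ψ univ) →
      ∃ (D' : Type) (_ : Finite D') (M' : ThickGraph (Cell N K) D' (Ω × Theta))
        (_ : Finite M'.E) (lab : M'.E → M.E) (ρ : D' → D)
        (st : ℝ × (ℕ → unitInterval) → D → D'),
        -- every edge of `M'` carries the weight and the stack operation of an edge of `M`
        (∀ e, (M'.wt e).1 = M.wt (lab e) ∧
          ∀ z, (M.real (lab e) z).2.2 = thetaAct (M'.wt e).2 z.2.2) ∧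
        -- `st` assigns, measurably, states of `M'` over each state of `M` to points of the space,
        -- and every state of `M'` occurs in every cell with positive measure
        (∀ y d, ρ (st y d) = d) ∧
        (∀ d d', MeasurableSet {y | st y d = d'}) ∧
        (∀ (c : Cell N K) (d' : D'),
          0 < spaceMeasure {z | InCell Ψ z c ∧ st (z.1, z.2.1) (ρ d') = d'}) ∧
        ∀ (w : List Bool) (ι : Fin (w.length + 1) → Fin K), Function.Injective ι →
        ∀ C : Set VSig, C = extSig ∨ C = ∅ →
        ∀ᵐ z ∂spaceMeasure, ∀ c : Cell N K, InCell Ψ z c → ∀ d : D,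
          -- every path of `M` and `!W` from `(z, d)` lifts to a unique path of the finite graphs
          (∀ p : (M.exec (wordRep Ψ u w ι) (region Ψ C)).E,
            Graphing.AltPath.source p = (d, ()) →
            z ∈ (M.exec (wordRep Ψ u w ι) (region Ψ C)).src p →
            ∃! q : (M'.exec (wordCells u w ι N) (Prod.fst ⁻¹' C)).E,
              LiesOver Ψ u w ι lab ρ q p ∧
              ThickGraph.AltPath.source q = (c, st (z.1, z.2.1) d, ())) ∧
          -- every path of the finite graphs from the vertex and state of `(z, d)` comes from a
          -- unique path of `M` and `!W` which is defined at `(z, d)` exactly when the stack tests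
          -- of `M` are passed; they always are if `M` does not test the stack
          (∀ q : (M'.exec (wordCells u w ι N) (Prod.fst ⁻¹' C)).E,
            ThickGraph.AltPath.source q = (c, st (z.1, z.2.1) d, ()) →
            ∃! p : (M.exec (wordRep Ψ u w ι) (region Ψ C)).E,
              LiesOver Ψ u w ι lab ρ q p ∧
              (z ∈ (M.exec (wordRep Ψ u w ι) (region Ψ C)).src p ↔
                Passes M'.wt (fun e => M.stackTest (lab e)) (ThickGraph.AltPath.edges q) z.2.2) ∧
              (M.StackBlind → z ∈ (M.exec (wordRep Ψ u w ι) (region Ψ C)).src p)) ∧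
          -- corresponding paths have the same weight, stack operation and endpoints
          (∀ (p : (M.exec (wordRep Ψ u w ι) (region Ψ C)).E)
            (q : (M'.exec (wordCells u w ι N) (Prod.fst ⁻¹' C)).E),
            LiesOver Ψ u w ι lab ρ q p →
            ThickGraph.AltPath.source q = (c, st (z.1, z.2.1) d, ()) →
            z ∈ (M.exec (wordRep Ψ u w ι) (region Ψ C)).src p →
            ((M'.exec (wordCells u w ι N) (Prod.fst ⁻¹' C)).wt q).1 =
              (M.exec (wordRep Ψ u w ι) (region Ψ C)).wt p ∧
            (∀ x : Space, ((M.exec (wordRep Ψ u w ι) (region Ψ C)).real p x).2.2 =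
              thetaAct ((M'.exec (wordCells u w ι N) (Prod.fst ⁻¹' C)).wt q).2 x.2.2) ∧
            ∀ z' : Space, z' = (M.exec (wordRep Ψ u w ι) (region Ψ C)).real p z →
              InCell Ψ z' (ThickGraph.AltPath.target q).1 ∧
              (ThickGraph.AltPath.target q).2 =
                (st (z'.1, z'.2.1) (Graphing.AltPath.target p).1, ())) := by
  have := hfin
  refine ⟨hM.exists_nMicro, fun N K _ hMN => ?_⟩
  choose k σ θ hreal using fun e => exists_normalMap_of_mem_nMicro (hMN.real_mem e)
  refine ⟨D × RealisedProfile N K Ψ M, inferInstance, cellGraph K Ψ M k σ θ, inferInstance,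
    cellGraphLab K Ψ M k σ θ, Prod.fst, stateAt Ψ M, fun e => ⟨rfl, fun z => ?_⟩,
    fun _ _ => rfl, measurableSet_stateAt_eq Ψ hM.measurable hrect,
    stateAt_pos Ψ hM.measurable hrect, fun w ι _ C _ => ?_⟩
  · rw [hreal]; rfl
  rcases eq_or_ne K 0 with rfl | hK
  -- without cells there is nothing to prove
  · exact .of_forall fun z c => (c.2 0).elim0
  filter_upwards [ae_generic (N := N) Ψ M hK] with z hz c hc d
  refine ⟨?_, ?_, ?_⟩
  · rintro ⟨m, hm, s, t⟩ rfl ⟨hzC, z', hzC', hrun⟩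
    obtain ⟨l, r, rfl, hl⟩ :=
      exists_run_above (k := k) (σ := σ) (θ := θ) hΨ hMN hrect hreal hz hc hrun
    obtain ⟨c', d', rfl, hz', hc', hiff, -⟩ := run_below hrect hreal hz hc hl rfl
    obtain ⟨hr, -⟩ := (hiff _).1 hrun
    obtain ⟨rfl, rfl⟩ := Prod.ext_iff.1 hr
    refine ⟨⟨l, (isAlternating_map _ _ l).1 hm, _, _, hl,
      fun h => hzC ((mem_region_iff hΨ hz.interior hc).2 h),
      fun h => hzC' ((mem_region_iff hΨ hz'.interior hc').2 h)⟩, ⟨⟨rfl, rfl, rfl⟩, rfl⟩, ?_⟩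
    rintro ⟨l₂, hl₂, _, t₂, hrun₂, h₃, h₄⟩ ⟨⟨h₁, -, -⟩, rfl⟩
    obtain ⟨rfl, rfl⟩ := run_above_unique hΨ h₁ hl hrun₂
    rfl
  · rintro ⟨l, hl, _, t, hrun, h₁, h₂⟩ rfl
    obtain ⟨c', d', rfl, hz', hc', hiff, hblind⟩ := run_below hrect hreal hz hc hrun rfl
    have hsrc : z ∈ (M.exec (wordRep Ψ u w ι) (region Ψ C)).src
        ⟨l.map (edgeBelow Ψ M k σ θ u w ι), (isAlternating_map _ _ l).2 hl, (d, ()), (d', ())⟩ ↔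
          TestsPassed Ψ M k σ θ u w ι l z.2.2 := by
      constructor
      · rintro ⟨-, z', -, h⟩
        exact ((hiff _).1 h).2
      · exact fun h => ⟨fun h' => h₁ ((mem_region_iff hΨ hz.interior hc).1 h'), _,
          fun h' => h₂ ((mem_region_iff hΨ hz'.interior hc').1 h'), (hiff _).2 ⟨rfl, h⟩⟩
    refine ⟨_, ⟨⟨rfl, rfl, rfl⟩, hsrc, fun hb => hsrc.2 (hblind hb)⟩, ?_⟩
    rintro ⟨m, hm, ⟨s, _⟩, ⟨t, _⟩⟩ ⟨⟨h₁, h₂, h₃⟩, -⟩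
    obtain rfl : m = _ := h₁
    obtain rfl : s = _ := h₂
    obtain rfl : t = _ := h₃
    rfl
  · rintro ⟨m, hm, s, t⟩ ⟨l, hl, _, r, hrun, hc₁, hc₂⟩ ⟨h₁, h₂, h₃⟩ rfl -
    obtain rfl : m = l.map (edgeBelow Ψ M k σ θ u w ι) := h₁
    refine ⟨pathWt_fst l, pathReal_stack hreal l, ?_⟩
    intro z' hz'
    obtain ⟨c', d', rfl, -, hc', -, -⟩ := run_below hrect hreal hz hc hrun hz'
    obtain rfl : t.1 = d' := h₃
    exact ⟨hc', rfl⟩
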